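/- **Theorem 2.3.** *Model.* A load balancer sends arriving jobs to finitely many servers $k$. Each server is non-idling and first-in-first-out, with an infinite buffer. Let $Q_k(0)$ be the initial number of jobs at server $k$, let $A_k(s,t]$ and $D_k(s,t]$ be the numbers of jobs sent to it and completed by it during $(s,t]$, and let $Q_k(t)=Q_k(0)+A_k(0,t]-D_k(0,t]$ be its queue length. The counts $Q_k(0)$ and $A_k(0,t]$ may be infinite (infinite backlog). The service time requirements at server $k$ have mean $1/\mu_k$ with $\mu_k>0$, and no server completes infinitely many jobs in finite time: for every server $k$ other than the server $i$ considered below, the sum of the service time requirements is almost surely infinite (for server $i$ this is automatic). *Approximation (MSR).* Server $k$ sends messages containing its queue length at times $t_k^1<t_k^2<\dots$; put $t_k^0=0$, and $t_k^{m+1}=\infty$ if no further message is sent. At each time $t_k^m$ the load balancer starts an emulated FIFO queue with initial length $Q_k(t_k^m)$, the same arrivals as server $k$ after $t_k^m$, and service time requirement $1/\mu_k$ for every job. Let $\tilde D_k(t_k^m,t]$ be the number of its departures during $(t_k^m,t]$. For $t\in[t_k^m,t_k^{m+1})$ the approximation $\tilde Q_k(t)$ of $Q_k(t)$ is the emulated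 queue length, and the approximation error is $$AE_k(t)=\bigl|D_k(t_k^m,t]-\tilde D_k(t_k^m,t]\bigr|,$$ which equals $|Q_k(t)-\tilde Q_k(t)|$ when the queues are finite. Put $AQ(t)=\max_k AE_k(t)$. *Communication (ET-$x$).* Each server sends its next message as soon as its approximation error reaches $x$, i.e. $t_k^{m+1}=\inf\{t>t_k^m: |D_k(t_k^m,t]-\tilde D_k(t_k^m,t]|\ge x\}$. *Assumptions.* Fix a server $i$ whose service time requirements are i.i.d. $\mathrm{Exp}(\mu_i)$. Nothing is assumed on the arrival process and the load balancing algorithm, except that they do not anticipate the future service times of server $i$: for each $t$, the number $Q_i(0)+A_i(0,t]$ is determined by (measurable with respect to) the departures $D_i(0,s]$, $s\le t$, together with information that is independent of the service time requirements at server $i$. (If $Q_i(0)=\infty$, this holds trivially.) *Claim.* Let $x\in\{2,3,4,\dots\}$ and $m\ge 0$. Let $I_i=[t_i^m,t_i^{m+1})$ be the interval between consecutive messages of server $i$ and $\tau_i=t_i^{m+1}-t_i^m$ its duration. Under ET-$x$ with MSR, almost surely $$AQ(t)\le x-1\quad\text{for all }t\in I_i .$$ Moreover, if server $i$ has an infinite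 backlog at the beginning of $I_i$, then $$\mathbb E[\tau_i]\ \ge\ \frac{x(x-1)}{\mu_i};$$ precisely, if the event $\{t_i^m<\infty,\ Q_i(t_i^m)=\infty\}$ has positive probability, then the conditional expectation of $\tau_i\in[0,\infty]$ given this event is at least $x(x-1)/\mu_i$. -/

import Mathlib

open MeasureTheory ProbabilityTheory
open scoped NNReal ENNReal

namespace CARE

/-! ### A single-server FIFO queue

Time is `ℝ≥0`. The function `N` counts the jobs that have been sent to the queue during `[0, t]`, the
jobs present initially included, and `s j` is the service time requirement of the `j`-th job
(jobs are numbered from `0` in their order of arrival). Counts take values in `ℕ∞`, so that a queue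
may hold infinitely many jobs. -/

/-- The arrival time of the `j`-th job: the first time at which more than `j` jobs have been sent
(`0` for jobs present initially, `∞` if there is no such job). -/
noncomputable def arrivalTime (N : ℝ≥0 → ℕ∞) (j : ℕ) : ℝ≥0∞ :=
  ⨅ (t : ℝ≥0) (_ : (j : ℕ∞) < N t), (t : ℝ≥0∞)

/-- The departure time of the `j`-th job under the non-idling FIFO discipline: its service starts as
soon as it has arrived and the previous job has departed. -/
noncomputable def departureTime (N : ℝ≥0 → ℕ∞) (s : ℕ → ℝ≥0) : ℕ → ℝ≥0∞
  | 0 => arrivalTime N 0 + s 0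
  | j + 1 => max (arrivalTime N (j + 1)) (departureTime N s j) + s (j + 1)

/-- The number of departures during `[0, t]`. -/
noncomputable def fifoDepartures (N : ℝ≥0 → ℕ∞) (s : ℕ → ℝ≥0) (t : ℝ≥0) : ℕ∞ :=
  {j : ℕ | departureTime N s j ≤ t}.encard

/-- Absolute difference of two (possibly infinite) counts. -/
noncomputable def absDiff (a b : ℕ∞) : ℕ∞ := max (a - b) (b - a)

/-- What is fed into one server, on one sample path: the initial number of jobs, the counting
process `arrivals t = A(0, t]` of the jobs that the load balancer sends to it after time zero, and the
service time requirements of the jobs it processes. A counting process is nondecreasing and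
right-continuous; infinite values represent an infinite backlog. -/
structure ServerInput where
  initial : ℕ∞
  arrivals : ℝ≥0 → ℕ∞
  requirement : ℕ → ℝ≥0
  arrivals_zero : arrivals 0 = 0
  arrivals_mono : Monotone arrivals
  arrivals_rightCont : ∀ t, ContinuousWithinAt arrivals (Set.Ici t) t

namespace ServerInput

variable (V : ServerInput)

/-- All jobs sent to the server during `[0, t]`, the initial ones included: `Q(0) + A(0, t]`. -/
def jobs (t : ℝ≥0) : ℕ∞ := V.initial + V.arrivals t

/-- The number `D(0, t]` of jobs the server has completed during `[0, t]`. -/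
noncomputable def departures (t : ℝ≥0) : ℕ∞ := fifoDepartures V.jobs V.requirement t

/-- The queue length `Q(t) = Q(0) + A(0, t] - D(0, t]`. -/
noncomputable def queueLength (t : ℝ≥0) : ℕ∞ := V.jobs t - V.departures t

/-! ### The emulation with mean service requirements (MSR)

The emulation that starts at the time `t₀` of a message is a FIFO queue that initially holds
`Q(t₀)` jobs, receives all arrivals after `t₀`, and assigns to every job the service time
requirement `1 / μ`. -/

/-- The jobs sent to the emulated queue up to `u` time units after its start: `Q(t₀) + A(t₀, t₀ + u]`.
(If infinitely many jobs have arrived by `t₀`, then `Q(t₀)` is already infinite.) -/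
noncomputable def emuJobs (t₀ u : ℝ≥0) : ℕ∞ :=
  V.queueLength t₀ + (V.arrivals (t₀ + u) - V.arrivals t₀)

/-- The number of departures during `(t₀, t]` from the emulated queue started at `t₀`. -/
noncomputable def emuDepartures (μ t₀ t : ℝ≥0) : ℕ∞ :=
  fifoDepartures (V.emuJobs t₀) (fun _ => μ⁻¹) (t - t₀)

/-- The length at time `t` of the emulated queue started at `t₀`. -/
noncomputable def emuQueue (μ t₀ t : ℝ≥0) : ℕ∞ :=
  V.emuJobs t₀ (t - t₀) - V.emuDepartures μ t₀ t

/-- The approximation error at time `t` of the emulation started at `t₀`: the absolute difference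
between the actual and the emulated number of departures during `(t₀, t]`. For finite queues this is
`|Q(t) - Q̃(t)|`, see `emuError_eq`; it still makes sense when both queues are infinite. -/
noncomputable def emuError (μ t₀ t : ℝ≥0) : ℕ∞ :=
  absDiff (V.departures t - V.departures t₀) (V.emuDepartures μ t₀ t)

/-! ### The error-triggered communication pattern ET-`x` -/

/-- The time of the `m`-th message (`∞` if there is none), where the `0`-th one is time zero: the next
message is sent when the error of the current emulation reaches `x`. -/
noncomputable def msgTime (μ : ℝ≥0) (x : ℕ) : ℕ → ℝ≥0∞
  | 0 => 0
  | m + 1 => ⨅ (t : ℝ≥0) (_ : msgTime μ x m < t ∧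
      (x : ℕ∞) ≤ V.emuError μ (msgTime μ x m).toNNReal t), (t : ℝ≥0∞)

/-- The number of messages sent up to time `t`. -/
noncomputable def msgCount (μ : ℝ≥0) (x : ℕ) (t : ℝ≥0) : ℕ :=
  sSup {m : ℕ | V.msgTime μ x m ≤ t}

/-- The approximation error `AE(t)`: the error of the emulation started at the last message. -/
noncomputable def approxError (μ : ℝ≥0) (x : ℕ) (t : ℝ≥0) : ℕ∞ :=
  V.emuError μ (V.msgTime μ x (V.msgCount μ x t)).toNNReal t

/-- The duration `τ` of the interval between the `m`-th and the next message (`∞` if there is no next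
message). -/
noncomputable def intervalDuration (μ : ℝ≥0) (x m : ℕ) : ℝ≥0∞ :=
  V.msgTime μ x (m + 1) - V.msgTime μ x m

/-- The `m`-th message is sent, and at that time the server has an infinite backlog. -/
def StartsBacklogged (μ : ℝ≥0) (x m : ℕ) : Prop :=
  V.msgTime μ x m < ∞ ∧ V.queueLength (V.msgTime μ x m).toNNReal = ⊤

end ServerInput

/-- The approximation quality `AQ(t)`: the maximal approximation error over all servers. -/
noncomputable def approxQuality {ι : Type*} (V : ι → ServerInput) (μ : ι → ℝ≥0) (x : ℕ) (t : ℝ≥0) :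
    ℕ∞ :=
  ⨆ k, (V k).approxError (μ k) x t

/-! ### For finite queues the error is the difference of the queue lengths -/

theorem fifoDepartures_mono (N : ℝ≥0 → ℕ∞) (s : ℕ → ℝ≥0) : Monotone (fifoDepartures N s) :=
  fun _ _ h => Set.encard_le_encard fun _ hj => le_trans hj (ENNReal.coe_le_coe.2 h)

theorem lt_of_arrivalTime_le {N : ℝ≥0 → ℕ∞} (hm : Monotone N)
    (hr : ∀ t, ContinuousWithinAt N (Set.Ici t) t) {j : ℕ} {t : ℝ≥0}
    (h : arrivalTime N j ≤ t) : (j : ℕ∞) < N t := by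
  have h2 : ∀ u > t, (j : ℕ∞) < N u := by
    intro u hu
    have h3 : arrivalTime N j < u := lt_of_le_of_lt h (ENNReal.coe_lt_coe.2 hu)
    simp only [arrivalTime, iInf_lt_iff] at h3
    obtain ⟨v, hv, hvu⟩ := h3
    exact hv.trans_le (hm (ENNReal.coe_lt_coe.1 hvu).le)
  by_contra hcon
  have h4 : N t < ((j + 1 : ℕ) : ℕ∞) :=
    lt_of_le_of_lt (not_lt.1 hcon) (by exact_mod_cast Nat.lt_succ_self j)
  have h5 : ∀ᶠ u in nhdsWithin t (Set.Ioi t), N u < ((j + 1 : ℕ) : ℕ∞) :=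
    ((hr t).mono Set.Ioi_subset_Ici_self).eventually (gt_mem_nhds h4)
  obtain ⟨u, hu1, hu2⟩ := (h5.and self_mem_nhdsWithin).exists
  have h6 := Order.add_one_le_of_lt (h2 u hu2)
  push_cast at hu1
  exact absurd hu1 (not_lt.2 h6)

theorem fifoDepartures_le {N : ℝ≥0 → ℕ∞} (hm : Monotone N)
    (hr : ∀ t, ContinuousWithinAt N (Set.Ici t) t) (s : ℕ → ℝ≥0) (t : ℝ≥0) :
    fifoDepartures N s t ≤ N t := by
  have h1 : {j : ℕ | departureTime N s j ≤ t} ⊆ {j : ℕ | (j : ℕ∞) < N t} := by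
    intro j hj
    refine lt_of_arrivalTime_le hm hr (le_trans ?_ hj)
    cases j with
    | zero => exact le_self_add
    | succ j => exact (le_max_left _ _).trans le_self_add
  refine (Set.encard_le_encard h1).trans ?_
  cases hN : N t with
  | top => exact le_top
  | coe n =>
    have : {j : ℕ | (j : ℕ∞) < (n : ℕ∞)} = (Finset.range n : Set ℕ) := by
      ext j; simp
    rw [this, Set.encard_coe_eq_coe_finsetCard]
    simp

/-- As long as only finitely many jobs have been sent to the server, the approximation error is the
absolute difference of the actual and the emulated queue length. -/
theorem ServerInput.emuError_eq (V : ServerInput) (μ : ℝ≥0) {t₀ t : ℝ≥0} (h : t₀ ≤ t)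
    (hfin : V.jobs t ≠ ⊤) :
    V.emuError μ t₀ t = absDiff (V.queueLength t) (V.emuQueue μ t₀ t) := by
  have hA : V.arrivals t ≠ ⊤ := fun h' => hfin (by simp [ServerInput.jobs, h'])
  have hI : V.initial ≠ ⊤ := fun h' => hfin (by simp [ServerInput.jobs, h'])
  have hA0 : V.arrivals t₀ ≠ ⊤ := ne_top_of_le_ne_top hA (V.arrivals_mono h)
  have hjm : Monotone V.jobs := fun a b hab => add_le_add_right (V.arrivals_mono hab) _
  have hjr : ∀ t, ContinuousWithinAt V.jobs (Set.Ici t) t := fun t =>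
    continuousWithinAt_const.add (V.arrivals_rightCont t)
  have hD : V.departures t ≤ V.jobs t := fifoDepartures_le hjm hjr _ _
  have hD0 : V.departures t₀ ≤ V.jobs t₀ := fifoDepartures_le hjm hjr _ _
  have hDD : V.departures t₀ ≤ V.departures t := fifoDepartures_mono _ _ h
  have hem : Monotone (V.emuJobs t₀) := fun a b hab =>
    add_le_add_right (tsub_le_tsub_right (V.arrivals_mono (add_le_add_right hab t₀)) _) _
  have her : ∀ u, ContinuousWithinAt (V.emuJobs t₀) (Set.Ici u) u := by
    intro u
    refine continuousWithinAt_const.add ?_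
    have h1 : ContinuousWithinAt (fun u => V.arrivals (t₀ + u)) (Set.Ici u) u :=
      (V.arrivals_rightCont (t₀ + u)).comp (f := fun u => t₀ + u)
        (by fun_prop) (fun v hv => add_le_add_right (show u ≤ v from hv) t₀)
    exact ((ENat.continuousAt_sub (Or.inr hA0)).tendsto.comp
      (h1.tendsto.prodMk_nhds tendsto_const_nhds))
  have hE : V.emuDepartures μ t₀ t ≤ V.emuJobs t₀ (t - t₀) := fifoDepartures_le hem her _ _
  have hA' := V.arrivals_mono h
  have hJ0 : V.jobs t₀ = V.initial + V.arrivals t₀ := rfl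
  have hJ : V.jobs t = V.initial + V.arrivals t := rfl
  unfold ServerInput.emuError ServerInput.emuQueue
  rw [show V.emuJobs t₀ (t - t₀) = V.queueLength t₀ + (V.arrivals t - V.arrivals t₀) by
    rw [ServerInput.emuJobs, add_tsub_cancel_of_le h]] at hE ⊢
  unfold ServerInput.queueLength at hE ⊢
  rw [hJ] at hD
  rw [hJ0] at hD0 hE
  rw [hJ, hJ0]
  lift V.arrivals t to ℕ using hA with a
  lift V.arrivals t₀ to ℕ using hA0 with a0
  lift V.initial to ℕ using hI with q
  generalize V.departures t = d at *
  generalize V.departures t₀ = d0 at *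
  generalize V.emuDepartures μ t₀ t = e at *
  lift d to ℕ using ne_top_of_le_ne_top (by exact_mod_cast ENat.natCast_ne_top (q + a)) hD
  lift d0 to ℕ using ne_top_of_le_ne_top (ENat.natCast_ne_top _) hDD
  lift e to ℕ using
    ne_top_of_le_ne_top (by exact_mod_cast ENat.natCast_ne_top (q + a0 - d0 + (a - a0))) hE
  unfold absDiff
  norm_cast at *
  have h1 : d - d0 - e = q + a0 - d0 + (a - a0) - e - (q + a - d) := by omega
  have h2 : e - (d - d0) = q + a - d - (q + a0 - d0 + (a - a0) - e) := by omega
  rw [h1, h2, max_comm]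

end CARE

/-! Error bound. Between two messages of a server, the server completes a job or at least `μ⁻¹`
units of time pass, since an error of at least one needs a real or an emulated departure. Hence
messages do not accumulate (`natCast_le_of_msgTime`), every time `t` has a last message before it,
and as the trigger has not fired since then, the integer error is at most `x - 1`
(`approxError_le`).

Mean duration. Measure time in units of `1 / μ`. With an infinite backlog the server's departures
form a Poisson process `N`, and the emulation has `⌊u⌋` departures by time `u`. If `|N - ⌊u⌋| ≥ x`,
then `Y = N - u` has left `(-x, x - 1]` (`exitTime_le`). Both `Y` and `Y ^ 2 - u` are martingales,
hence so is `Y ^ 2 + Y - u`. At an exit through `-x` the value of `Y ^ 2 + Y` is `x (x - 1)`; at an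
upper exit it is larger, because of the overshoot. So the mean exit time from `0` is at least `x (x
- 1)`. Optional stopping is replaced by a one-jump inequality (`ofReal_exitMean_le_lintegral`),
iterated `k` times with a geometrically small remainder (`lintegral_exitMean_le`).

The start of the interval is a random time that depends on the history. The paths are split by the
number `n` of departures before it. Up to the `n`-th departure (jobs numbered from zero), arrivals,
departures and messages agree with versions measurable with respect to `U` and the first `n`
requirements (`exists_isPastVersion`, `min_seqMsgTime_congr`). The event in question then says that
a past event holds and that requirement `n` exceeds the service already given, a level known from
the past. By memorylessness the excess is again exponential (`lintegral_residual`). Summing over `n`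
gives the conditional expectation. -/

namespace CARE

/-! ### Departure times of a FIFO queue and their counting functions -/

/-- The number of terms of the sequence `d` that are at most `t`. -/
noncomputable def countUpTo (d : ℕ → ℝ≥0∞) (t : ℝ≥0∞) : ℕ∞ := {j | d j ≤ t}.encard

/-- FIFO departure times for given arrival times `a` and service time requirements `s`. -/
noncomputable def serve (a : ℕ → ℝ≥0∞) (s : ℕ → ℝ≥0) : ℕ → ℝ≥0∞
  | 0 => a 0 + s 0
  | j + 1 => max (a (j + 1)) (serve a s j) + s (j + 1)

theorem departureTime_eq_serve (N : ℝ≥0 → ℕ∞) (s : ℕ → ℝ≥0) :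
    departureTime N s = serve (arrivalTime N) s := by
  funext j
  induction j with
  | zero => rfl
  | succ j ih => simp only [departureTime, serve, ih]

theorem arrival_le_serve (a : ℕ → ℝ≥0∞) (s : ℕ → ℝ≥0) (j : ℕ) : a j + s j ≤ serve a s j := by
  cases j with
  | zero => exact le_rfl
  | succ j => exact add_le_add_left (le_max_left _ _) _

theorem sum_le_serve (a : ℕ → ℝ≥0∞) (s : ℕ → ℝ≥0) (j : ℕ) :
    ∑ l ∈ Finset.range (j + 1), (s l : ℝ≥0∞) ≤ serve a s j := by
  induction j with
  | zero => simp [serve]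
  | succ j ih =>
    rw [Finset.sum_range_succ]
    exact add_le_add_left (ih.trans (le_max_right _ _)) _

theorem serve_mono (a : ℕ → ℝ≥0∞) (s : ℕ → ℝ≥0) : Monotone (serve a s) :=
  monotone_nat_of_le_succ fun _ => (le_max_right _ _).trans le_self_add

/-- A departure cannot precede the total service of all jobs up to and including it, so a divergent
total leaves room for only finitely many departures. -/
theorem finite_serve_le {a : ℕ → ℝ≥0∞} {s : ℕ → ℝ≥0} (hs : ∑' j, (s j : ℝ≥0∞) = ∞) (t : ℝ≥0) :
    {j | serve a s j ≤ t}.Finite := by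
  by_contra hinf
  have hle : ∀ n, ∑ l ∈ Finset.range n, (s l : ℝ≥0∞) ≤ t := by
    intro n
    obtain ⟨j, hj, hnj⟩ := (Set.not_finite.1 hinf |>.exists_gt n)
    refine le_trans ?_ ((sum_le_serve a s j).trans hj)
    exact Finset.sum_le_sum_of_subset (Finset.range_mono (by omega))
  have := ENNReal.tsum_le_of_sum_range_le hle
  rw [hs] at this
  exact absurd this (by simp)

theorem tsum_const_inv {μ : ℝ≥0} (hμ : 0 < μ) : ∑' _ : ℕ, ((μ⁻¹ : ℝ≥0) : ℝ≥0∞) = ∞ :=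
  ENNReal.tsum_const_eq_top_of_ne_zero (by simpa using hμ.ne')

/-- A locally finite counting function is locally constant to the right. -/
theorem exists_countUpTo_eq {d : ℕ → ℝ≥0∞} (hd : ∀ t : ℝ≥0, {j | d j ≤ t}.Finite) (t : ℝ≥0) :
    ∃ t' : ℝ≥0, t < t' ∧ ∀ u : ℝ≥0, t ≤ u → u < t' → countUpTo d u = countUpTo d t := by
  -- Only the finitely many terms up to `t + 1` could join the count before `t + 1`, and each of
  -- those beyond `t` stays out for a while.
  have hev : ∀ᶠ u : ℝ≥0 in nhdsWithin t (Set.Ioi t), ∀ j ∈ {j | d j ≤ (t + 1 : ℝ≥0)},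
      (d j ≤ u → d j ≤ t) := by
    rw [Filter.eventually_all_finite (hd _)]
    intro j _
    by_cases hj : d j ≤ t
    · exact Filter.Eventually.of_forall fun _ _ => hj
    · have : ∀ᶠ u : ℝ≥0 in nhds t, (u : ℝ≥0∞) < d j :=
        (ENNReal.continuous_coe.tendsto t).eventually (gt_mem_nhds (not_le.1 hj))
      filter_upwards [this.filter_mono nhdsWithin_le_nhds] with u hu h
      exact absurd h (not_le.2 hu)
  obtain ⟨t', ht', h⟩ := (mem_nhdsGT_iff_exists_Ioo_subset).1 hev
  refine ⟨min t' (t + 1), lt_min ht' (by simp), fun u htu hu => ?_⟩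
  rcases htu.eq_or_lt with rfl | htu
  · rfl
  refine le_antisymm (Set.encard_le_encard fun j hj => ?_)
    (Set.encard_le_encard fun j (hj : d j ≤ t) => hj.trans (ENNReal.coe_le_coe.2 htu.le))
  refine h ⟨htu, hu.trans_le (min_le_left _ _)⟩ j ?_ hj
  exact (show d j ≤ u from hj).trans (ENNReal.coe_le_coe.2 (hu.trans_le (min_le_right _ _)).le)

theorem countUpTo_ne_top {d : ℕ → ℝ≥0∞} (hd : ∀ t : ℝ≥0, {j | d j ≤ t}.Finite) (t : ℝ≥0) :
    countUpTo d t ≠ ⊤ :=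
  (Set.encard_ne_top_iff).2 (hd t)

theorem one_le_absDiff {a b : ℕ∞} (h : 1 ≤ absDiff a b) : 1 ≤ a ∨ 1 ≤ b := by
  rcases le_max_iff.1 h with h | h
  · exact Or.inl (h.trans tsub_le_self)
  · exact Or.inr (h.trans tsub_le_self)

/-! ### Messages do not accumulate; the error bound -/

namespace ServerInput

variable (V : ServerInput)

/-- The departure times of a server. -/
noncomputable def depTime : ℕ → ℝ≥0∞ := serve (arrivalTime V.jobs) V.requirement

theorem departures_eq (t : ℝ≥0) : V.departures t = countUpTo V.depTime t := by
  rw [departures, fifoDepartures, departureTime_eq_serve]; rfl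

theorem emuDepartures_eq (μ t₀ t : ℝ≥0) :
    V.emuDepartures μ t₀ t =
      countUpTo (serve (arrivalTime (V.emuJobs t₀)) fun _ => μ⁻¹) (t - t₀ : ℝ≥0) := by
  rw [emuDepartures, fifoDepartures, departureTime_eq_serve]; rfl

variable {V} in
theorem finite_depTime_le (hV : ∑' j, (V.requirement j : ℝ≥0∞) = ∞) (t : ℝ≥0) :
    {j | V.depTime j ≤ t}.Finite := finite_serve_le hV t

theorem inv_le_of_one_le_emuDepartures {μ t₀ t : ℝ≥0} (h : 1 ≤ V.emuDepartures μ t₀ t) :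
    μ⁻¹ ≤ t - t₀ := by
  rw [emuDepartures_eq, countUpTo, Set.one_le_encard_iff_nonempty] at h
  obtain ⟨j, hj⟩ := h
  have h1 := (le_add_self.trans (arrival_le_serve _ _ _)).trans hj
  exact_mod_cast h1

theorem msgTime_le_succ (μ : ℝ≥0) (x m : ℕ) : V.msgTime μ x m ≤ V.msgTime μ x (m + 1) :=
  le_iInf₂ fun _ ht => ht.1.le

theorem exists_of_msgTime_lt {μ : ℝ≥0} {x m : ℕ} {u : ℝ≥0∞} (h : V.msgTime μ x (m + 1) < u) :
    ∃ t : ℝ≥0, (t : ℝ≥0∞) < u ∧ V.msgTime μ x m < t ∧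
      (x : ℕ∞) ≤ V.emuError μ (V.msgTime μ x m).toNNReal t := by
  rw [msgTime] at h
  simp only [iInf_lt_iff] at h
  obtain ⟨t, ht, htu⟩ := h
  exact ⟨t, htu, ht⟩

variable {V} in
/-- Between consecutive messages the server completes a job, or the time for an emulated service
elapses. -/
theorem message_progress (hV : ∑' j, (V.requirement j : ℝ≥0∞) = ∞) {μ : ℝ≥0} {x m : ℕ}
    (hx : 1 ≤ x) {t₀ t₁ : ℝ≥0} (h₀ : V.msgTime μ x m = t₀) (h₁ : V.msgTime μ x (m + 1) = t₁) :
    V.departures t₀ + 1 ≤ V.departures t₁ ∨ t₀ + μ⁻¹ ≤ t₁ := by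
  by_contra! hcon
  obtain ⟨hD, ht⟩ := hcon
  -- The infimum `t₁` is approached by triggering times `t`. One is chosen so close to `t₁` that
  -- there are no new departures in `(t₁, t]` and `t < t₀ + μ⁻¹`.
  obtain ⟨t', ht', hc⟩ := exists_countUpTo_eq (finite_depTime_le hV) t₁
  obtain ⟨t, htu, hmt, he⟩ := V.exists_of_msgTime_lt (μ := μ) (x := x) (m := m)
    (u := (min t' (t₀ + μ⁻¹) : ℝ≥0)) (by
      rw [h₁]; exact_mod_cast lt_min ht' ht)
  have ht1 : t₁ ≤ t := by
    have : V.msgTime μ x (m + 1) ≤ t := iInf₂_le t ⟨hmt, he⟩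
    rw [h₁] at this; exact_mod_cast this
  have htt : t < min t' (t₀ + μ⁻¹) := by exact_mod_cast htu
  have hDt : V.departures t = V.departures t₁ := by
    rw [departures_eq, departures_eq]
    exact hc t ht1 (htt.trans_le (min_le_left _ _))
  rw [h₀, ENNReal.toNNReal_coe] at he
  rcases one_le_absDiff (le_trans (by exact_mod_cast hx) he) with h | h
  · rw [hDt, Order.one_le_iff_pos, tsub_pos_iff_lt] at h
    exact absurd (Order.add_one_le_of_lt h) (not_le.2 hD)
  · have h2 := V.inv_le_of_one_le_emuDepartures h
    have h3 : t₀ ≤ t := by rw [h₀] at hmt; exact_mod_cast hmt.le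
    have h4 : t₀ + μ⁻¹ ≤ t := by
      rw [add_comm]; exact add_le_of_le_tsub_right_of_le h3 h2
    exact absurd h4 (not_le.2 (htt.trans_le (min_le_right _ _)))

variable {V} in
-- By `message_progress`, the quantity `D + μ t` grows by at least one from each message to the
-- next.
theorem natCast_le_of_msgTime (hV : ∑' j, (V.requirement j : ℝ≥0∞) = ∞) {μ : ℝ≥0} (hμ : 0 < μ)
    {x : ℕ} (hx : 1 ≤ x) (m : ℕ) {t : ℝ≥0} (h : V.msgTime μ x m ≤ t) :
    (m : ℝ≥0) ≤ ((V.departures t).toNat : ℝ≥0) + μ * t := by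
  have hfin : ∀ t, V.departures t ≠ ⊤ := fun t => by
    rw [departures_eq]; exact countUpTo_ne_top (finite_depTime_le hV) _
  induction m generalizing t with
  | zero => simp
  | succ m ih =>
    obtain ⟨t₁, ht₁⟩ : ∃ t₁ : ℝ≥0, (t₁ : ℝ≥0∞) = _ := WithTop.ne_top_iff_exists.1 (ne_top_of_le_ne_top ENNReal.coe_ne_top h)
    have h0 := V.msgTime_le_succ μ x m
    obtain ⟨t₀, ht₀⟩ : ∃ t₀ : ℝ≥0, (t₀ : ℝ≥0∞) = _ := WithTop.ne_top_iff_exists.1 (ne_top_of_le_ne_top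
      (ENNReal.coe_ne_top (r := t₁)) (ht₁ ▸ h0))
    have h01 : t₀ ≤ t₁ := by rw [← ht₀, ← ht₁] at h0; exact_mod_cast h0
    have h1t : t₁ ≤ t := by rw [← ht₁] at h; exact_mod_cast h
    have hm := ih ht₀.ge
    have hD1 : (V.departures t₁).toNat ≤ (V.departures t).toNat :=
      ENat.toNat_le_toNat (fifoDepartures_mono _ _ h1t) (hfin t)
    have hD0 : (V.departures t₀).toNat ≤ (V.departures t₁).toNat :=
      ENat.toNat_le_toNat (fifoDepartures_mono _ _ h01) (hfin t₁)
    have hmt : μ * t₁ ≤ μ * t := mul_le_mul_right h1t μ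
    rcases message_progress hV hx ht₀.symm ht₁.symm with h | h
    · have h2 : (V.departures t₀).toNat + 1 ≤ (V.departures t).toNat := by
        have := ENat.toNat_le_toNat (h.trans (fifoDepartures_mono _ _ h1t)) (hfin t)
        rwa [ENat.toNat_add (hfin _) (by simp)] at this
      have h3 : μ * t₀ ≤ μ * t := mul_le_mul_right (h01.trans h1t) μ
      calc ((m + 1 : ℕ) : ℝ≥0) = m + 1 := by push_cast; rfl
        _ ≤ ((V.departures t₀).toNat + μ * t₀) + 1 := by gcongr
        _ = ((V.departures t₀).toNat + 1 : ℕ) + μ * t₀ := by push_cast; ring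
        _ ≤ _ := by gcongr
    · have h3 : μ * t₀ + 1 ≤ μ * t := by
        calc μ * t₀ + 1 = μ * (t₀ + μ⁻¹) := by rw [mul_add, mul_inv_cancel₀ hμ.ne']
          _ ≤ μ * t := mul_le_mul_right (h.trans h1t) μ
      calc ((m + 1 : ℕ) : ℝ≥0) = m + 1 := by push_cast; rfl
        _ ≤ ((V.departures t₀).toNat + μ * t₀) + 1 := by gcongr
        _ = (V.departures t₀).toNat + (μ * t₀ + 1) := by ring
        _ ≤ _ := by
          exact add_le_add (by exact_mod_cast hD0.trans hD1) h3

theorem emuError_self {μ : ℝ≥0} (hμ : 0 < μ) (t : ℝ≥0) : V.emuError μ t t = 0 := by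
  have h : V.emuDepartures μ t t = 0 := by
    by_contra hne
    have := V.inv_le_of_one_le_emuDepartures (Order.one_le_iff_ne_zero.2 hne)
    simp [hμ.ne'] at this
  have h2 : V.departures t - V.departures t = 0 := tsub_eq_zero_of_le le_rfl
  rw [emuError, h, h2]; simp [absDiff]

variable {V} in
-- After the last message the trigger has not fired, so the error is below `x`; at the instant of
-- the message, which the trigger excludes, the fresh emulation has error zero.
theorem approxError_le (hV : ∑' j, (V.requirement j : ℝ≥0∞) = ∞) {μ : ℝ≥0} (hμ : 0 < μ)
    {x : ℕ} (hx : 1 ≤ x) (t : ℝ≥0) : V.approxError μ x t ≤ ((x - 1 : ℕ) : ℕ∞) := by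
  -- Without boundedness `sSup` would default to `0` and `msgCount` would not point at the last
  -- message.
  have hbdd : BddAbove {m : ℕ | V.msgTime μ x m ≤ t} := by
    obtain ⟨n, hn⟩ := exists_nat_ge (((V.departures t).toNat : ℝ≥0) + μ * t)
    exact ⟨n, fun m hm => by exact_mod_cast (natCast_le_of_msgTime hV hμ hx m hm).trans hn⟩
  have hne : {m : ℕ | V.msgTime μ x m ≤ t}.Nonempty := ⟨0, by simp [msgTime]⟩
  have hmem : V.msgTime μ x (V.msgCount μ x t) ≤ t := Nat.sSup_mem hne hbdd
  have hnot : ¬ V.msgTime μ x (V.msgCount μ x t + 1) ≤ t := fun h =>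
    absurd (le_csSup hbdd h) (not_le.2 (Nat.lt_succ_self (V.msgCount μ x t)))
  rw [approxError]
  generalize V.msgCount μ x t = m at *
  rcases hmem.eq_or_lt with h | h
  · rw [h, ENNReal.toNNReal_coe, V.emuError_self hμ]; exact zero_le
  · have h2 : ¬ (x : ℕ∞) ≤ V.emuError μ (V.msgTime μ x m).toNNReal t := fun he =>
      hnot (iInf₂_le t ⟨h, he⟩)
    have h3 := not_le.1 h2
    refine Order.le_of_lt_add_one (h3.trans_le ?_)
    exact_mod_cast (by omega : x ≤ x - 1 + 1)

end ServerInput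

/-! ### The messages as a functional of arrival and departure times -/

/-- The error at time `t` of the emulation started at time `T`, in terms of the arrival times `a` and
the departure times `d`. -/
noncomputable def seqError (μ : ℝ≥0) (a d : ℕ → ℝ≥0∞) (T t : ℝ≥0∞) : ℕ∞ :=
  absDiff (countUpTo d t - countUpTo d T)
    (countUpTo (serve (fun j => a ((countUpTo d T).toNat + j) - T) fun _ => μ⁻¹) (t - T))

/-- The message times in terms of the arrival times `a` and the departure times `d`; the infimum
runs over a countable set. -/
noncomputable def seqMsgTime (μ : ℝ≥0) (x : ℕ) (a d : ℕ → ℝ≥0∞) : ℕ → ℝ≥0∞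
  | 0 => 0
  | m + 1 => ⨅ (q : ℚ) (_ : seqMsgTime μ x a d m < (q : ℝ).toNNReal ∧
      (x : ℕ∞) ≤ seqError μ a d (seqMsgTime μ x a d m) (q : ℝ).toNNReal),
      ((q : ℝ).toNNReal : ℝ≥0∞)

theorem arrivalTime_le {N : ℝ≥0 → ℕ∞} {j : ℕ} {t : ℝ≥0} (h : (j : ℕ∞) < N t) :
    arrivalTime N j ≤ t := iInf₂_le t h

namespace ServerInput

variable (V : ServerInput)

theorem jobs_mono : Monotone V.jobs := fun _ _ h => add_le_add_right (V.arrivals_mono h) _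

theorem jobs_rightCont (t : ℝ≥0) : ContinuousWithinAt V.jobs (Set.Ici t) t :=
  continuousWithinAt_const.add (V.arrivals_rightCont t)

theorem departures_le_jobs (t : ℝ≥0) : V.departures t ≤ V.jobs t :=
  fifoDepartures_le V.jobs_mono V.jobs_rightCont _ _

/-- The arrival times at a server. -/
noncomputable def arrTime : ℕ → ℝ≥0∞ := arrivalTime V.jobs

theorem arrTime_le_iff {j : ℕ} {t : ℝ≥0} : V.arrTime j ≤ t ↔ (j : ℕ∞) < V.jobs t :=
  ⟨lt_of_arrivalTime_le V.jobs_mono V.jobs_rightCont, arrivalTime_le⟩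

variable {V} in
-- The convention `⊤ - ⊤ = 0` does no harm: if infinitely many jobs have arrived by `t₀`, finiteness
-- of the departures makes the queue length infinite already.
theorem emuJobs_eq {t₀ : ℝ≥0} (h : V.departures t₀ ≠ ⊤) (u : ℝ≥0) :
    V.emuJobs t₀ u = V.jobs (t₀ + u) - V.departures t₀ := by
  have hD : V.departures t₀ ≤ V.initial + V.arrivals t₀ := V.departures_le_jobs t₀
  have hA := V.arrivals_mono (le_self_add : t₀ ≤ t₀ + u)
  unfold emuJobs queueLength jobs
  generalize V.departures t₀ = D at *
  generalize V.arrivals t₀ = A at *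
  generalize V.arrivals (t₀ + u) = B at *
  generalize V.initial = I at *
  lift D to ℕ using h
  induction I using ENat.recTopCoe with
  | top => simp
  | coe I =>
    induction A using ENat.recTopCoe with
    | top => simp [top_le_iff.1 hA]
    | coe A =>
      induction B using ENat.recTopCoe with
      | top => simp
      | coe B => norm_cast at *; omega

variable {V} in
/-- The `j`-th job in the emulation is the `(D + j)`-th job of the server, where `D` counts the
departures until the start of the emulation. -/
theorem arrivalTime_emuJobs {t₀ : ℝ≥0} (h : V.departures t₀ ≠ ⊤) (j : ℕ) :
    arrivalTime (V.emuJobs t₀) j = V.arrTime ((V.departures t₀).toNat + j) - t₀ := by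
  obtain ⟨K, hK⟩ := ENat.ne_top_iff_exists.1 h
  have key : ∀ u, ((j : ℕ∞) < V.emuJobs t₀ u ↔ ((K + j : ℕ) : ℕ∞) < V.jobs (t₀ + u)) := by
    intro u
    rw [emuJobs_eq h, ← hK, lt_tsub_iff_left]
    push_cast; rfl
  rw [← hK, ENat.toNat_natCast]
  refine le_antisymm ?_ (le_iInf₂ fun u hu => ?_)
  · rcases eq_or_ne (V.arrTime (K + j)) ∞ with htop | htop
    · rw [htop, ENNReal.top_sub_coe]; exact le_top
    · lift V.arrTime (K + j) to ℝ≥0 using htop with v hv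
      have h1 : ((K + j : ℕ) : ℕ∞) < V.jobs v := V.arrTime_le_iff.1 hv.ge
      rw [← ENNReal.coe_sub]
      exact arrivalTime_le ((key _).2 (h1.trans_le (V.jobs_mono le_add_tsub)))
  · rw [tsub_le_iff_left]
    exact_mod_cast V.arrTime_le_iff.2 ((key u).1 hu)

end ServerInput

/-- Agreement of two histories before time `c` is encoded as equality after capping at `c`; this
form passes through the maxima and sums of the FIFO recursion. -/
theorem countUpTo_congr {d d' : ℕ → ℝ≥0∞} {c t : ℝ≥0∞} (h : ∀ j, min (d j) c = min (d' j) c)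
    (ht : t < c) : countUpTo d t = countUpTo d' t := by
  have key : ∀ j, (d j ≤ t ↔ d' j ≤ t) := by
    intro j
    have h1 : ∀ y : ℝ≥0∞, y ≤ t ↔ min y c ≤ t := fun y => by
      rw [min_le_iff, or_iff_left (not_le.2 ht)]
    rw [h1, h j, ← h1]
  simp only [countUpTo, key]

theorem min_serve_congr {a a' : ℕ → ℝ≥0∞} {c : ℝ≥0∞} (h : ∀ j, min (a j) c = min (a' j) c)
    (s : ℕ → ℝ≥0) (j : ℕ) : min (serve a s j) c = min (serve a' s j) c := by
  have h1 : ∀ y z : ℝ≥0∞, min (y + z) c = min (min y c + z) c := by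
    intro y z
    rcases le_total y c with hy | hy
    · rw [min_eq_left hy]
    · rw [min_eq_right hy, min_eq_right (hy.trans le_self_add), min_eq_right le_self_add]
  induction j with
  | zero => rw [serve, serve, h1, h 0, ← h1]
  | succ j ih => rw [serve, serve, h1, inf_sup_right, h, ih, ← inf_sup_right, ← h1]

/-- The error at time `t` depends only on what has happened up to time `t`. -/
theorem seqError_congr {μ : ℝ≥0} {a a' d d' : ℕ → ℝ≥0∞} {c T t : ℝ≥0∞}
    (ha : ∀ j, min (a j) c = min (a' j) c) (hd : ∀ j, min (d j) c = min (d' j) c)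
    (hT : T < t) (ht : t < c) : seqError μ a d T t = seqError μ a' d' T t := by
  unfold seqError
  rw [countUpTo_congr hd ht, countUpTo_congr hd (hT.trans ht)]
  congr 1
  -- The emulation runs on a clock started at `T`, so the cap moves to `c - T`.
  refine countUpTo_congr (c := c - T) (fun j => min_serve_congr (fun j => ?_) _ j) ?_
  · have hm : Monotone fun y : ℝ≥0∞ => y - T := fun _ _ h => tsub_le_tsub_right h T
    rw [← hm.map_min, ← hm.map_min, ha]
  · exact (ENNReal.cancel_of_ne hT.ne_top).tsub_lt_tsub_right_of_le hT.le ht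

/-- The message times are stopping times. -/
theorem min_seqMsgTime_congr {μ : ℝ≥0} {x : ℕ} {a a' d d' : ℕ → ℝ≥0∞} {c : ℝ≥0∞}
    (ha : ∀ j, min (a j) c = min (a' j) c) (hd : ∀ j, min (d j) c = min (d' j) c) (m : ℕ) :
    min (seqMsgTime μ x a d m) c = min (seqMsgTime μ x a' d' m) c := by
  -- One inequality for arbitrary histories suffices, since their roles can be exchanged. A rational
  -- time beyond `c` is absorbed by the cap; one before `c` sees the same previous message and the
  -- same error.
  have step : ∀ {a a' d d' : ℕ → ℝ≥0∞} (m : ℕ), (∀ j, min (a j) c = min (a' j) c) →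
      (∀ j, min (d j) c = min (d' j) c) →
      min (seqMsgTime μ x a d m) c = min (seqMsgTime μ x a' d' m) c →
      min (seqMsgTime μ x a d (m + 1)) c ≤ min (seqMsgTime μ x a' d' (m + 1)) c := by
    intro a a' d d' m ha hd ih
    refine le_min (le_iInf₂ fun q hq => ?_) (min_le_right _ _)
    rcases le_or_gt c ((q : ℝ).toNNReal : ℝ≥0∞) with hc | hc
    · exact (min_le_right _ _).trans hc
    · have h1 : seqMsgTime μ x a d m = seqMsgTime μ x a' d' m := by
        rw [min_eq_left (hq.1.trans hc).le] at ih
        rcases min_choice (seqMsgTime μ x a d m) c with h | h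
        · rw [← h, ih]
        · rw [h] at ih; exact absurd (hq.1.trans hc) (not_lt.2 ih.le)
      refine (min_le_left _ _).trans (iInf₂_le q ⟨h1 ▸ hq.1, ?_⟩)
      rw [h1, seqError_congr ha hd hq.1 hc]
      exact hq.2
  induction m with
  | zero => rfl
  | succ m ih =>
    exact le_antisymm (step m ha hd ih)
      (step m (fun j => (ha j).symm) (fun j => (hd j).symm) ih.symm)

namespace ServerInput

variable {V : ServerInput}

theorem emuDepartures_eq_countUpTo (μ : ℝ≥0) {t₀ : ℝ≥0} (h : V.departures t₀ ≠ ⊤) (t : ℝ≥0) :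
    V.emuDepartures μ t₀ t = countUpTo (serve (fun j => V.arrTime
      ((V.departures t₀).toNat + j) - t₀) fun _ => μ⁻¹) (t - t₀ : ℝ≥0) := by
  rw [emuDepartures_eq, funext (arrivalTime_emuJobs h)]

theorem emuError_eq_seqError (μ : ℝ≥0) {t₀ : ℝ≥0} (h : V.departures t₀ ≠ ⊤) (t : ℝ≥0) :
    V.emuError μ t₀ t = seqError μ V.arrTime V.depTime t₀ t := by
  rw [emuError, emuDepartures_eq_countUpTo μ h, seqError, ← departures_eq, ← departures_eq,
    ENNReal.coe_sub]

theorem departures_ne_top (hV : ∑' j, (V.requirement j : ℝ≥0∞) = ∞) (t : ℝ≥0) :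
    V.departures t ≠ ⊤ := by
  rw [departures_eq]; exact countUpTo_ne_top (finite_depTime_le hV) _

theorem exists_emuError_eq (hV : ∑' j, (V.requirement j : ℝ≥0∞) = ∞) {μ : ℝ≥0} (hμ : 0 < μ)
    {t₀ t : ℝ≥0} (h : t₀ ≤ t) :
    ∃ t', t < t' ∧ ∀ u, t ≤ u → u < t' → V.emuError μ t₀ u = V.emuError μ t₀ t := by
  obtain ⟨t₁, ht₁, h₁⟩ := exists_countUpTo_eq (finite_depTime_le hV) t
  obtain ⟨t₂, ht₂, h₂⟩ := exists_countUpTo_eq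
    (finite_serve_le (a := fun j => V.arrTime ((V.departures t₀).toNat + j) - t₀)
      (tsum_const_inv hμ)) (t - t₀)
  refine ⟨min t₁ (t₀ + t₂), lt_min ht₁ ?_, fun u htu hu => ?_⟩
  · exact (tsub_lt_iff_left h).1 ht₂
  · rw [emuError, emuError, departures_eq V u, h₁ u htu (hu.trans_le (min_le_left _ _)),
      ← departures_eq, emuDepartures_eq_countUpTo μ (departures_ne_top hV _),
      emuDepartures_eq_countUpTo μ (departures_ne_top hV _),
      h₂ (u - t₀) (tsub_le_tsub_right htu _)
        ((tsub_lt_iff_left (h.trans htu)).2 (hu.trans_le (min_le_right _ _)))]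

/-- The error is constant for a while after each triggering time, so there are rational triggering
times arbitrarily close to its right. -/
theorem msgTime_eq_seqMsgTime (hV : ∑' j, (V.requirement j : ℝ≥0∞) = ∞) {μ : ℝ≥0} (hμ : 0 < μ)
    (x m : ℕ) : V.msgTime μ x m = seqMsgTime μ x V.arrTime V.depTime m := by
  induction m with
  | zero => rfl
  | succ m ih =>
    have herr : ∀ t : ℝ≥0, V.msgTime μ x m < t →
        V.emuError μ (V.msgTime μ x m).toNNReal t =
          seqError μ V.arrTime V.depTime (V.msgTime μ x m) t := by
      intro t ht
      rw [emuError_eq_seqError μ (departures_ne_top hV _), ENNReal.coe_toNNReal ht.ne_top]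
    rw [msgTime, seqMsgTime, ← ih]
    apply le_antisymm
    · refine le_iInf₂ fun q hq => iInf₂_le _ ⟨hq.1, ?_⟩
      rw [herr _ hq.1]; exact hq.2
    · refine le_iInf₂ fun t ht => le_of_forall_gt_imp_ge_of_dense fun u hu => ?_
      have h0 : (V.msgTime μ x m).toNNReal ≤ t :=
        (ENNReal.toNNReal_le_toNNReal ht.1.ne_top ENNReal.coe_ne_top).2 ht.1.le
      obtain ⟨t', ht', h⟩ := exists_emuError_eq hV hμ h0
      obtain ⟨q, -, hq1, hq2⟩ := ENNReal.lt_iff_exists_rat_btwn.1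
        (show (t : ℝ≥0∞) < min u t' from lt_min hu (ENNReal.coe_lt_coe.2 ht'))
      have h1 : t ≤ (q : ℝ).toNNReal := by exact_mod_cast hq1.le
      have h2 : (q : ℝ).toNNReal < t' := by exact_mod_cast hq2.trans_le (min_le_right _ _)
      refine (iInf₂_le q ⟨ht.1.trans hq1, ?_⟩).trans (hq2.le.trans (min_le_left _ _))
      rw [← herr _ (ht.1.trans hq1), h _ h1 h2]
      exact ht.2

end ServerInput

/-! ### Measurability of the message times -/

section Measurability

variable {Ω : Type*} [MeasurableSpace Ω]

/-- Having at least `k` elements means containing one of the countably many finite sets of size `k`.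
-/
theorem measurable_encard {S : Ω → Set ℕ} (hS : ∀ j, MeasurableSet {ω | j ∈ S ω}) :
    Measurable fun ω => (S ω).encard := by
  have hmeas : ∀ k : ℕ, MeasurableSet {ω | (k : ℕ∞) ≤ (S ω).encard} := by
    intro k
    have : {ω | (k : ℕ∞) ≤ (S ω).encard} =
        ⋃ F ∈ {F : Finset ℕ | F.card = k}, ⋂ j ∈ F, {ω | j ∈ S ω} := by
      ext ω
      simp only [Set.mem_ofPred_eq, Set.mem_iUnion, Set.mem_iInter, exists_prop]
      constructor
      · intro h
        obtain ⟨t, ht, htc⟩ := Set.exists_subset_encard_eq h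
        have hfin : t.Finite := Set.finite_of_encard_eq_coe htc
        refine ⟨hfin.toFinset, ?_, fun j hj => ht (by simpa using hj)⟩
        have := hfin.encard_eq_coe_toFinset_card
        rw [htc] at this
        exact_mod_cast this.symm
      · rintro ⟨F, hF, h⟩
        rw [← hF, ← Set.encard_coe_eq_coe_finsetCard]
        exact Set.encard_le_encard fun j hj => h j hj
    rw [this]
    exact MeasurableSet.biUnion (Set.to_countable _) fun F _ =>
      Finset.measurableSet_biInter F fun j _ => hS j
  refine measurable_to_countable' fun n => ?_
  induction n using ENat.recTopCoe with
  | top =>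
    have : (fun ω => (S ω).encard) ⁻¹' {⊤} = ⋂ k : ℕ, {ω | (k : ℕ∞) ≤ (S ω).encard} := by
      ext ω
      simp [ENat.eq_top_iff_forall_ge]
    rw [this]
    exact MeasurableSet.iInter hmeas
  | coe n =>
    have : (fun ω => (S ω).encard) ⁻¹' {(n : ℕ∞)} =
        {ω | (n : ℕ∞) ≤ (S ω).encard} \ {ω | ((n + 1 : ℕ) : ℕ∞) ≤ (S ω).encard} := by
      ext ω
      simp only [Set.mem_preimage, Set.mem_singleton_iff, Set.mem_sdiff, Set.mem_ofPred_eq, not_le]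
      constructor
      · intro h; rw [h]; exact ⟨le_rfl, by exact_mod_cast Nat.lt_succ_self n⟩
      · rintro ⟨h1, h2⟩
        refine le_antisymm (Order.le_of_lt_add_one ?_) h1
        exact_mod_cast h2
    rw [this]
    exact (hmeas n).diff (hmeas (n + 1))

theorem measurable_countUpTo {d : ℕ → Ω → ℝ≥0∞} {t : Ω → ℝ≥0∞} (hd : ∀ j, Measurable (d j))
    (ht : Measurable t) : Measurable fun ω => countUpTo (fun j => d j ω) (t ω) :=
  measurable_encard fun j => measurableSet_le (hd j) ht

theorem measurable_serve {a : ℕ → Ω → ℝ≥0∞} (ha : ∀ j, Measurable (a j)) (s : ℕ → ℝ≥0) (j : ℕ) :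
    Measurable fun ω => serve (fun j => a j ω) s j := by
  induction j with
  | zero => exact (ha 0).add_const _
  | succ j ih => exact ((ha (j + 1)).max ih).add_const _

theorem measurable_seqError (μ : ℝ≥0) {a d : ℕ → Ω → ℝ≥0∞} (ha : ∀ j, Measurable (a j))
    (hd : ∀ j, Measurable (d j)) {T : Ω → ℝ≥0∞} (hT : Measurable T) (t : ℝ≥0∞) :
    Measurable fun ω => seqError μ (fun j => a j ω) (fun j => d j ω) (T ω) t := by
  have hK := measurable_countUpTo hd hT
  have hE : ∀ j, Measurable fun ω =>
      a ((countUpTo (fun j => d j ω) (T ω)).toNat + j) ω - T ω := by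
    intro j
    refine Measurable.sub ?_ hT
    -- The job index is itself random, but takes countably many values.
    have h1 : Measurable fun p : ℕ × Ω => a (p.1 + j) p.2 :=
      measurable_from_prod_countable_right fun n => ha (n + j)
    exact h1.comp (((measurable_of_countable ENat.toNat).comp hK).prodMk measurable_id)
  have hc := measurable_countUpTo (measurable_serve hE fun _ => μ⁻¹) ((measurable_const (a := t)).sub hT)
  exact (measurable_of_countable fun p : ℕ∞ × ℕ∞ => absDiff p.1 p.2).comp
    ((((measurable_of_countable fun p : ℕ∞ × ℕ∞ => p.1 - p.2).comp
      ((measurable_countUpTo hd measurable_const).prodMk hK))).prodMk hc)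

theorem measurable_seqMsgTime (μ : ℝ≥0) (x : ℕ) {a d : ℕ → Ω → ℝ≥0∞} (ha : ∀ j, Measurable (a j))
    (hd : ∀ j, Measurable (d j)) (m : ℕ) :
    Measurable fun ω => seqMsgTime μ x (fun j => a j ω) (fun j => d j ω) m := by
  induction m with
  | zero => exact measurable_const
  | succ m ih =>
    simp only [seqMsgTime]
    refine Measurable.iInf fun q => ?_
    simp only [iInf_eq_if]
    refine Measurable.ite ?_ measurable_const measurable_const
    refine (measurableSet_lt ih measurable_const).inter ?_
    exact measurable_seqError μ ha hd ih _ (MeasurableSet.of_discrete (s := Set.Ici (x : ℕ∞)))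

end Measurability

/-! ### Versions of the history that do not anticipate service times -/

theorem measurable_iInf_mem {κ Ω : Type*} [MeasurableSpace Ω] [Countable κ] {E : κ → Set Ω}
    (hE : ∀ q, MeasurableSet (E q)) (c : κ → ℝ≥0∞) :
    Measurable fun ω => ⨅ (q : κ) (_ : ω ∈ E q), c q := by
  classical
  refine Measurable.iInf fun q => ?_
  simp only [iInf_eq_if]
  exact Measurable.ite (hE q) measurable_const measurable_const

/-- The start of the service of the `n`-th job under FIFO. -/
noncomputable def startTime (a d : ℕ → ℝ≥0∞) : ℕ → ℝ≥0∞
  | 0 => a 0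
  | n + 1 => max (a (n + 1)) (d n)

theorem serve_eq_startTime_add (a : ℕ → ℝ≥0∞) (s : ℕ → ℝ≥0) (n : ℕ) :
    serve a s n = startTime a (serve a s) n + s n := by
  cases n <;> rfl

section

variable {Ω : Type*}

/-- The information `U` together with the first `n` service time requirements. -/
@[reducible] def pastSpace (U : MeasurableSpace Ω) (V : Ω → ServerInput) (n : ℕ) : MeasurableSpace Ω :=
  U ⊔ ⨆ j : ℕ, ⨆ _ : j < n, MeasurableSpace.comap (fun ω => (V ω).requirement j) inferInstance

/-- The information `U` together with the departures up to time `t`. -/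
@[reducible] noncomputable def departureSpace (U : MeasurableSpace Ω) (V : Ω → ServerInput) (t : ℝ≥0) : MeasurableSpace Ω :=
  U ⊔ ⨆ s : ℝ≥0, ⨆ _ : s ≤ t,
    MeasurableSpace.comap (fun ω => (V ω).departures s) inferInstance

theorem pastSpace_mono (U : MeasurableSpace Ω) (V : Ω → ServerInput) :
    Monotone (pastSpace U V) := fun _ _ h =>
  sup_le le_sup_left (iSup₂_le fun j hj => le_trans
    (le_iSup₂_of_le (f := fun (j : ℕ) (_ : j < _) =>
      MeasurableSpace.comap (fun ω => (V ω).requirement j) inferInstance) j (hj.trans_le h) le_rfl)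
    le_sup_right)

theorem measurable_requirement_pastSpace (U : MeasurableSpace Ω) (V : Ω → ServerInput) (n : ℕ) :
    Measurable[pastSpace U V (n + 1)] fun ω => (V ω).requirement n := by
  refine measurable_iff_comap_le.2 (le_trans ?_ le_sup_right)
  exact le_iSup₂_of_le n (Nat.lt_succ_self n) le_rfl

/-- The paths on which all service time requirements are positive and their sum is infinite. -/
def regularPaths (V : Ω → ServerInput) : Set Ω :=
  {ω | (∀ j, 0 < (V ω).requirement j) ∧ ∑' j, ((V ω).requirement j : ℝ≥0∞) = ∞}

/-- `α` and `δ` agree with the arrival and departure times up to the `n`-th departure, and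
anticipate no service time requirement from the `n`-th one on. -/
structure IsPastVersion (U : MeasurableSpace Ω) (V : Ω → ServerInput) (n : ℕ)
    (α δ : ℕ → Ω → ℝ≥0∞) : Prop where
  measurable_arr : ∀ j, Measurable[pastSpace U V n] (α j)
  measurable_dep : ∀ j, Measurable[pastSpace U V n] (δ j)
  arr_eq : ∀ ω ∈ regularPaths V, ∀ j,
    min ((V ω).arrTime j) ((V ω).depTime n) = min (α j ω) ((V ω).depTime n)
  dep_eq : ∀ ω ∈ regularPaths V, ∀ j,
    min ((V ω).depTime j) ((V ω).depTime n) = min (δ j ω) ((V ω).depTime n)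
  dep_eq_of_lt : ∀ ω ∈ regularPaths V, ∀ j < n, (V ω).depTime j = δ j ω

variable {U : MeasurableSpace Ω} {V : Ω → ServerInput} {n : ℕ}

/-- On the event that the `n`-th job has not left by time `t`, the departures up to time `t` are
determined by the past. -/
theorem departureSpace_trace {δ : ℕ → Ω → ℝ≥0∞}
    (hδ : ∀ j, Measurable[pastSpace U V n] (δ j))
    (hd : ∀ ω ∈ regularPaths V, ∀ j,
      min ((V ω).depTime j) ((V ω).depTime n) = min (δ j ω) ((V ω).depTime n))
    (t : ℝ≥0) {E : Set Ω} (hE : MeasurableSet[departureSpace U V t] E) :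
    ∃ E', MeasurableSet[pastSpace U V n] E' ∧
      ∀ ω ∈ regularPaths V, (t : ℝ≥0∞) < (V ω).depTime n → (ω ∈ E ↔ ω ∈ E') := by
  let D : Set Ω := {ω | ω ∈ regularPaths V ∧ (t : ℝ≥0∞) < (V ω).depTime n}
  -- The sets whose trace on `D` is the trace of a past event form a σ-algebra, so only the
  -- generators need checking.
  have hle : departureSpace U V t ≤ ((pastSpace U V n).comap (Subtype.val : D → Ω)).map
      Subtype.val := by
    refine sup_le (fun E hE => ⟨E, (le_sup_left : U ≤ pastSpace U V n) E hE, rfl⟩)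
      (iSup₂_le fun s hs => ?_)
    rintro _ ⟨B, -, rfl⟩
    refine ⟨(fun ω => countUpTo (fun j => δ j ω) s) ⁻¹' B, ?_, ?_⟩
    · exact (@measurable_countUpTo _ (pastSpace U V n) _ _ hδ (measurable_const (a := (s : ℝ≥0∞))))
        (MeasurableSet.of_discrete (s := B))
    · ext ⟨ω, hω⟩
      simp only [Set.mem_preimage]
      rw [ServerInput.departures_eq, countUpTo_congr (hd ω hω.1)
        (lt_of_le_of_lt (ENNReal.coe_le_coe.2 hs) hω.2)]
  obtain ⟨E', hE', h⟩ := hle E hE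
  refine ⟨E', hE', fun ω h1 h2 => ?_⟩
  have := Set.ext_iff.1 h ⟨ω, h1, h2⟩
  exact this.symm

/-- Before the `n`-th departure, having received more than `j` jobs by time `t` coincides with a
past event. The first rational time at which that event holds serves as the version of the arrival
time. -/
theorem exists_arrival_version {δ : ℕ → Ω → ℝ≥0∞}
    (hadapted : ∀ t, Measurable[departureSpace U V t] fun ω => (V ω).jobs t)
    (hδ : ∀ j, Measurable[pastSpace U V n] (δ j))
    (hd : ∀ ω ∈ regularPaths V, ∀ j,
      min ((V ω).depTime j) ((V ω).depTime n) = min (δ j ω) ((V ω).depTime n)) :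
    ∃ α : ℕ → Ω → ℝ≥0∞, (∀ j, Measurable[pastSpace U V n] (α j)) ∧
      ∀ ω ∈ regularPaths V, ∀ j,
        min ((V ω).arrTime j) ((V ω).depTime n) = min (α j ω) ((V ω).depTime n) := by
  have h : ∀ (t : ℝ≥0) (j : ℕ), ∃ E', MeasurableSet[pastSpace U V n] E' ∧
      ∀ ω ∈ regularPaths V, (t : ℝ≥0∞) < (V ω).depTime n →
        ((j : ℕ∞) < (V ω).jobs t ↔ ω ∈ E') := fun t j =>
    departureSpace_trace hδ hd t (hadapted t (MeasurableSet.of_discrete (s := Set.Ioi (j : ℕ∞))))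
  choose E hE hEiff using h
  refine ⟨fun j ω => ⨅ (q : ℚ) (_ : ω ∈ E (q : ℝ).toNNReal j), ((q : ℝ).toNNReal : ℝ≥0∞),
    fun j => ?_, fun ω hω j => ?_⟩
  · exact @measurable_iInf_mem _ _ (pastSpace U V n) _ _ (fun q => hE _ _) _
  · apply le_antisymm
    · refine le_min (le_iInf₂ fun q hq => ?_) (min_le_right _ _)
      rcases le_or_gt ((V ω).depTime n) ((q : ℝ).toNNReal : ℝ≥0∞) with hc | hc
      · exact (min_le_right _ _).trans hc
      · exact (min_le_left _ _).trans
          ((V ω).arrTime_le_iff.2 ((hEiff _ j ω hω hc).2 hq))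
    · refine le_min (le_of_forall_gt_imp_ge_of_dense fun u hu => ?_) (min_le_right _ _)
      obtain ⟨q, -, hq1, hq2⟩ := ENNReal.lt_iff_exists_rat_btwn.1 hu
      refine le_trans ?_ hq2.le
      rcases le_or_gt ((V ω).depTime n) ((q : ℝ).toNNReal : ℝ≥0∞) with hc | hc
      · exact (min_le_right _ _).trans hc
      · exact (min_le_left _ _).trans
          (iInf₂_le q ((hEiff _ j ω hω hc).1 ((V ω).arrTime_le_iff.1 hq1.le)))

/-- A job with positive requirement arrives strictly before it departs, or never does either; so the
cap at its own departure loses nothing. -/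
theorem arrTime_eq_of_min_eq {W : ServerInput} (hs : 0 < W.requirement n) {y : ℝ≥0∞}
    (h : min (W.arrTime n) (W.depTime n) = min y (W.depTime n)) : W.arrTime n = y := by
  have h1 : W.arrTime n + W.requirement n ≤ W.depTime n := arrival_le_serve _ _ _
  rcases eq_or_ne (W.arrTime n) ∞ with htop | htop
  · rw [htop, top_add, top_le_iff] at h1
    rw [h1, min_eq_left le_top, min_eq_left le_top] at h
    exact h
  · have h2 : W.arrTime n < W.depTime n :=
      (ENNReal.lt_add_right htop (by simpa using hs.ne')).trans_le h1
    rw [min_eq_left h2.le] at h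
    rcases min_choice y (W.depTime n) with h3 | h3
    · rw [h, h3]
    · rw [h3] at h; exact absurd h h2.ne

theorem startTime_eq_of_version {α δ : ℕ → Ω → ℝ≥0∞}
    (ha : ∀ ω ∈ regularPaths V, ∀ j,
      min ((V ω).arrTime j) ((V ω).depTime n) = min (α j ω) ((V ω).depTime n))
    (hd : ∀ ω ∈ regularPaths V, ∀ j < n, (V ω).depTime j = δ j ω) {ω : Ω}
    (hω : ω ∈ regularPaths V) :
    startTime (V ω).arrTime (V ω).depTime n = startTime (fun j => α j ω) (fun j => δ j ω) n := by
  have h := arrTime_eq_of_min_eq (hω.1 n) (ha ω hω n)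
  cases n with
  | zero => exact h
  | succ n => simp only [startTime]; rw [← h, ← hd ω hω n (Nat.lt_succ_self n)]

theorem measurable_startTime {Ω : Type*} [MeasurableSpace Ω] {α δ : ℕ → Ω → ℝ≥0∞}
    (hα : ∀ j, Measurable (α j)) (hδ : ∀ j, Measurable (δ j)) (n : ℕ) :
    Measurable fun ω => startTime (fun j => α j ω) (fun j => δ j ω) n := by
  cases n with
  | zero => exact hα 0
  | succ n => exact (hα (n + 1)).max (hδ n)

/-- Induction along the feedback loop: the departures before job `n` determine the arrivals up to
its departure, these determine when its service starts, and adding requirement `n` gives its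
departure time. Later departures are set to `∞`, which the cap makes invisible. -/
theorem exists_isPastVersion
    (hadapted : ∀ t, Measurable[departureSpace U V t] fun ω => (V ω).jobs t) (n : ℕ) :
    ∃ α δ, IsPastVersion U V n α δ := by
  suffices H : ∃ δ : ℕ → Ω → ℝ≥0∞, (∀ j, Measurable[pastSpace U V n] (δ j)) ∧
      (∀ ω ∈ regularPaths V, ∀ j,
        min ((V ω).depTime j) ((V ω).depTime n) = min (δ j ω) ((V ω).depTime n)) ∧
      ∀ ω ∈ regularPaths V, ∀ j < n, (V ω).depTime j = δ j ω by
    obtain ⟨δ, h1, h2, h3⟩ := H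
    obtain ⟨α, h4, h5⟩ := exists_arrival_version hadapted h1 h2
    exact ⟨α, δ, h4, h1, h5, h2, h3⟩
  have hmono : ∀ ω, Monotone (V ω).depTime := fun ω => serve_mono _ _
  induction n with
  | zero =>
    refine ⟨fun _ _ => ∞, fun _ => measurable_const, fun ω _ j => ?_, fun _ _ _ h => by omega⟩
    rw [min_eq_right (hmono ω (Nat.zero_le j)), min_eq_right le_top]
  | succ n ih =>
    obtain ⟨δ, h1, h2, h3⟩ := ih
    obtain ⟨α, h4, h5⟩ := exists_arrival_version hadapted h1 h2
    have hlt : ∀ ω ∈ regularPaths V, ∀ j < n + 1, (V ω).depTime j =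
        if j < n then δ j ω else if j = n then
          startTime (fun j => α j ω) (fun j => δ j ω) n + (V ω).requirement n else ∞ := by
      intro ω hω j hj
      rcases Nat.lt_succ_iff_lt_or_eq.1 hj with h | rfl
      · rw [if_pos h, h3 ω hω j h]
      · rw [if_neg (lt_irrefl _), if_pos rfl, ← startTime_eq_of_version h5 h3 hω]
        exact serve_eq_startTime_add _ _ _
    refine ⟨fun j ω => if j < n then δ j ω else if j = n then
      startTime (fun j => α j ω) (fun j => δ j ω) n + (V ω).requirement n else ∞,
      fun j => ?_, fun ω hω j => ?_, hlt⟩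
    · have hle := pastSpace_mono U V (Nat.le_succ n)
      dsimp only
      split_ifs
      · exact (h1 j).mono hle le_rfl
      · have h6 := (@measurable_startTime _ (pastSpace U V n) _ _ h4 h1 n).mono hle le_rfl
        exact h6.add
          (measurable_coe_nnreal_ennreal.comp (measurable_requirement_pastSpace U V n))
      · exact measurable_const
    · dsimp only
      rcases lt_or_ge j (n + 1) with hj | hj
      · rw [hlt ω hω j hj]
      · rw [if_neg (by omega), if_neg (by omega), min_eq_right (hmono ω hj), min_eq_right le_top]

end

/-! ### Independence of the past from the next service time -/

section

variable {Ω : Type*} {mΩ : MeasurableSpace Ω} {P : Measure Ω}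

/-- The sets `u ∩ a` form a π-system generating `U ⊔ A`; on them the product rule follows by
splitting off `u` first and then separating `a` from `b`. -/
theorem indep_sup_left [IsProbabilityMeasure P] {U A B : MeasurableSpace Ω} (hU : U ≤ mΩ)
    (hA : A ≤ mΩ) (hB : B ≤ mΩ) (h : Indep U (A ⊔ B) P) (hAB : Indep A B P) :
    Indep (U ⊔ A) B P := by
  let S : Set (Set Ω) := {E | ∃ u a, MeasurableSet[U] u ∧ MeasurableSet[A] a ∧ E = u ∩ a}
  have hS : U ⊔ A = MeasurableSpace.generateFrom S := by
    apply le_antisymm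
    · refine sup_le (fun u hu => MeasurableSpace.measurableSet_generateFrom
        ⟨u, Set.univ, hu, MeasurableSet.univ, by simp⟩)
        (fun a ha => MeasurableSpace.measurableSet_generateFrom
        ⟨Set.univ, a, MeasurableSet.univ, ha, by simp⟩)
    · refine MeasurableSpace.generateFrom_le ?_
      rintro _ ⟨u, a, hu, ha, rfl⟩
      exact MeasurableSet.inter ((le_sup_left : U ≤ U ⊔ A) u hu) ((le_sup_right : A ≤ U ⊔ A) a ha)
  have hpi : IsPiSystem S := by
    rintro _ ⟨u, a, hu, ha, rfl⟩ _ ⟨u', a', hu', ha', rfl⟩ -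
    exact ⟨u ∩ u', a ∩ a', @MeasurableSet.inter _ U _ _ hu hu', @MeasurableSet.inter _ A _ _ ha ha',
      Set.inter_inter_inter_comm _ _ _ _⟩
  refine IndepSets.indep (sup_le hU hA) hB hpi (@MeasurableSpace.isPiSystem_measurableSet _ B) hS
    (@MeasurableSpace.generateFrom_measurableSet _ B).symm ?_
  rw [IndepSets_iff]
  rintro _ b ⟨u, a, hu, ha, rfl⟩ hb
  rw [Indep_iff] at h hAB
  have ha' : MeasurableSet[A ⊔ B] a := (le_sup_left : A ≤ A ⊔ B) a ha
  have hb' : MeasurableSet[A ⊔ B] b := (le_sup_right : B ≤ A ⊔ B) b hb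
  rw [Set.inter_assoc, h u _ hu (@MeasurableSet.inter _ (A ⊔ B) _ _ ha' hb'), hAB a b ha hb,
    h u a hu ha', mul_assoc]

/-- The past is independent of the next service time requirement. -/
theorem indep_pastSpace [IsProbabilityMeasure P] {U : MeasurableSpace Ω} (hU : U ≤ mΩ)
    {V : Ω → ServerInput} (hreq : ∀ j, Measurable[mΩ] fun ω => (V ω).requirement j)
    (hindep : iIndepFun (fun j ω => (V ω).requirement j) P)
    (hUindep : Indep U
      (⨆ j, MeasurableSpace.comap (fun ω => (V ω).requirement j) inferInstance) P) (n : ℕ) :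
    Indep (pastSpace U V n)
      (MeasurableSpace.comap (fun ω => (V ω).requirement n) inferInstance) P := by
  have hle : ∀ j, MeasurableSpace.comap (fun ω => (V ω).requirement j) inferInstance ≤ mΩ :=
    fun j => (hreq j).comap_le
  refine indep_sup_left hU (iSup₂_le fun j _ => hle j) (hle n) ?_ ?_
  · exact indep_of_indep_of_le_right hUindep
      (sup_le (iSup₂_le fun j _ => le_iSup (fun j => MeasurableSpace.comap
        (fun ω => (V ω).requirement j) inferInstance) j) (le_iSup (fun j => MeasurableSpace.comap
        (fun ω => (V ω).requirement j) inferInstance) n))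
  · have h := indep_iSup_of_disjoint hle hindep.iIndep (S := {j | j < n}) (T := {n})
      (by simp)
    simpa using h

theorem pastSpace_le {U : MeasurableSpace Ω} (hU : U ≤ mΩ)
    {V : Ω → ServerInput} (hreq : ∀ j, Measurable[mΩ] fun ω => (V ω).requirement j) (n : ℕ) :
    pastSpace U V n ≤ mΩ :=
  sup_le hU (iSup₂_le fun j _ => (hreq j).comap_le)

end

/-! ### The exponential distribution with rate one -/

theorem lintegral_expMeasure_one {F : ℝ → ℝ≥0∞} (hF : Measurable F) :
    ∫⁻ r, F r ∂expMeasure 1 = ∫⁻ r in Set.Ioi 0, ENNReal.ofReal (Real.exp (-r)) * F r := by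
  have h : expMeasure 1 = volume.withDensity (exponentialPDF 1) := rfl
  have hm : Measurable (exponentialPDF 1) := (measurable_exponentialPDFReal 1).ennreal_ofReal
  rw [h, lintegral_withDensity_eq_lintegral_mul _ hm hF, ← lintegral_indicator measurableSet_Ioi]
  refine lintegral_congr_ae ?_
  filter_upwards [(Set.countable_singleton (0 : ℝ)).ae_notMem volume] with r hr
  rcases lt_trichotomy r 0 with h | h | h
  · rw [Set.indicator_of_notMem (by simpa using h.le), Pi.mul_apply, exponentialPDF_of_neg h,
      zero_mul]
  · exact absurd h hr
  · rw [Set.indicator_of_mem (by simpa using h), Pi.mul_apply, exponentialPDF_of_nonneg h.le]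
    simp

/-- The exponential distribution is memoryless. -/
theorem lintegral_expMeasure_shift {F : ℝ → ℝ≥0∞} (hF : Measurable F) {w : ℝ} (hw : 0 ≤ w) :
    ∫⁻ r, (if w < r then F (r - w) else 0) ∂expMeasure 1 =
      ENNReal.ofReal (Real.exp (-w)) * ∫⁻ r, F r ∂expMeasure 1 := by
  have hm : Measurable fun r : ℝ => if w < r then F (r - w) else 0 :=
    Measurable.ite (measurableSet_Ioi (a := w)) (hF.comp (measurable_id.sub_const w))
      measurable_const
  have hm2 : Measurable fun r => ENNReal.ofReal (Real.exp (-r)) * F r := by fun_prop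
  rw [lintegral_expMeasure_one hm, lintegral_expMeasure_one hF,
    ← lintegral_indicator measurableSet_Ioi, ← lintegral_indicator measurableSet_Ioi,
    ← lintegral_const_mul _ (hm2.indicator measurableSet_Ioi),
    ← lintegral_sub_right_eq_self (fun r => ENNReal.ofReal (Real.exp (-w)) * _) w]
  refine lintegral_congr fun r => ?_
  by_cases h : w < r
  · rw [Set.indicator_of_mem (by simpa using hw.trans_lt h),
      Set.indicator_of_mem (by simpa using h), if_pos h, ← mul_assoc,
      ← ENNReal.ofReal_mul (Real.exp_pos _).le, ← Real.exp_add]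
    congr 3; ring
  · rw [Set.indicator_of_notMem (a := r - w) (by simpa using h)]
    simp [Set.indicator, h]

theorem expMeasure_map_mul {μ : ℝ} (hμ : 0 < μ) :
    (expMeasure μ).map (fun r => μ * r) = expMeasure 1 := by
  have := isProbabilityMeasure_expMeasure hμ
  have := isProbabilityMeasure_expMeasure one_pos
  have hm : Measurable fun r : ℝ => μ * r := by fun_prop
  have := Measure.isProbabilityMeasure_map (μ := expMeasure μ) hm.aemeasurable
  refine Measure.eq_of_cdf _ _ ?_
  ext t
  have h1 : cdf ((expMeasure μ).map fun r => μ * r) t = cdf (expMeasure μ) (t / μ) := by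
    rw [cdf_eq_real, cdf_eq_real, map_measureReal_apply hm measurableSet_Iic]
    congr 1
    ext r
    simp [le_div_iff₀ hμ, mul_comm]
  rw [h1, cdf_expMeasure_eq hμ, cdf_expMeasure_eq one_pos, mul_div_cancel₀ _ hμ.ne', one_mul]
  simp [div_nonneg_iff, hμ.le, hμ.not_ge]

theorem ae_expMeasure_one_pos : ∀ᵐ r ∂expMeasure 1, 0 < r := by
  have h : expMeasure 1 = volume.withDensity (exponentialPDF 1) := rfl
  have hm : Measurable (exponentialPDF 1) := (measurable_exponentialPDFReal 1).ennreal_ofReal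
  rw [h, ae_withDensity_iff hm]
  filter_upwards [(Set.countable_singleton (0 : ℝ)).ae_notMem volume] with r hr hne
  rcases lt_trichotomy r 0 with h | h | h
  · exact absurd (exponentialPDF_of_neg h) hne
  · exact absurd h hr
  · exact h

theorem expMeasure_one_Iio_le {t : ℝ} (ht : 0 ≤ t) :
    expMeasure 1 (Set.Iio t) ≤ ENNReal.ofReal (1 - Real.exp (-t)) := by
  have := isProbabilityMeasure_expMeasure one_pos
  refine (measure_mono Set.Iio_subset_Iic_self).trans ?_
  rw [← ofReal_cdf, cdf_expMeasure_eq one_pos, if_pos ht, one_mul]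

/-! ### Exit from the interval `(-x, x - 1]` of the difference between a Poisson process and time

From the value `y`, the difference decreases at unit rate until the next jump, where it
increases by one. -/

/-- The exit time, truncated after `k` jumps. The times between jumps are `r 0, r 1, …`. -/
noncomputable def exitTime (x : ℝ) : ℕ → ℝ → (ℕ → ℝ) → ℝ≥0∞
  | 0, _, _ => 0
  | k + 1, y, r => ENNReal.ofReal (min (r 0) (y + x)) +
      if r 0 < y + x ∧ y + 1 - r 0 ≤ x - 1 then
        exitTime x k (y + 1 - r 0) (fun j => r (j + 1)) else 0

/-- The mean exit time if there were no overshoot. -/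
def exitMean (x y : ℝ) : ℝ := x * (x - 1) - (y ^ 2 + y)

theorem ofReal_integral_le_lintegral {α : Type*} [MeasurableSpace α] {ν : Measure α} (h : α → ℝ) :
    ENNReal.ofReal (∫ r, h r ∂ν) ≤ ∫⁻ r, ENNReal.ofReal (h r) ∂ν := by
  by_cases hi : Integrable h ν
  · rw [← ENNReal.ofReal_toReal (a := ∫⁻ r, ENNReal.ofReal (h r) ∂ν) hi.lintegral_lt_top.ne]
    refine ENNReal.ofReal_le_ofReal ?_
    rw [integral_eq_lintegral_pos_part_sub_lintegral_neg_part hi]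
    exact sub_le_self _ ENNReal.toReal_nonneg
  · simp [integral_undef hi]

/-- The antiderivative rests on `exitMean x (z + 1) = exitMean x z - 2 * z - 2`, which is the
martingale property of `Y ^ 2 + Y - u`. The upper limit corresponds to the level `-x`, where
`exitMean` vanishes. -/
theorem integral_exitMean (x y : ℝ) :
    ∫ r in (0 : ℝ)..(y + x), Real.exp (-r) * (r + exitMean x (y + 1 - r)) =
      exitMean x y - (y + x) * Real.exp (-(y + x)) := by
  have hd : ∀ r ∈ Set.uIcc 0 (y + x), HasDerivAt
      (fun r => -(Real.exp (-r) * (r + exitMean x (y - r))))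
      (Real.exp (-r) * (r + exitMean x (y + 1 - r))) r := by
    intro r _
    have h1 : HasDerivAt (fun r : ℝ => Real.exp (-r)) (-Real.exp (-r)) r := by
      simpa using (hasDerivAt_neg r).exp
    have h2 : HasDerivAt (fun r : ℝ => y - r) (-1) r := by
      simpa using (hasDerivAt_id r).const_sub y
    have h3 : HasDerivAt (fun r => r + exitMean x (y - r)) (1 + (2 * (y - r) + 1)) r := by
      refine (hasDerivAt_id r).add ?_
      convert! ((h2.pow 2).add h2).const_sub (x * (x - 1)) using 1
      push_cast
      ring
    convert! (h1.mul h3).neg using 1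
    simp only [exitMean]
    ring
  rw [intervalIntegral.integral_eq_sub_of_hasDerivAt hd]
  · simp only [exitMean]
    rw [neg_zero, Real.exp_zero]
    ring
  · refine Continuous.intervalIntegrable ?_ _ _
    unfold exitMean
    fun_prop

/-- Condition on the first jump time `r`. If `r > y + x`, the lower boundary is hit at time `y + x`.
Otherwise time `r` is spent and the process restarts one higher; after an upper exit the omitted
`exitMean` is nonpositive. -/
theorem ofReal_exitMean_le_lintegral {x y : ℝ} (hy : -x < y) :
    ENNReal.ofReal (exitMean x y) ≤ ∫⁻ r, (ENNReal.ofReal (min r (y + x)) +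
      if r < y + x ∧ y + 1 - r ≤ x - 1 then ENNReal.ofReal (exitMean x (y + 1 - r)) else 0)
        ∂expMeasure 1 := by
  have hc : 0 < y + x := by linarith
  have hm : Measurable fun r : ℝ => ENNReal.ofReal (min r (y + x)) +
      if r < y + x ∧ y + 1 - r ≤ x - 1 then ENNReal.ofReal (exitMean x (y + 1 - r)) else 0 := by
    unfold exitMean
    refine (Measurable.ennreal_ofReal (by fun_prop)).add
      (Measurable.ite ?_ (Measurable.ennreal_ofReal (by fun_prop)) measurable_const)
    exact (measurableSet_lt measurable_id measurable_const).inter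
      (measurableSet_le (f := fun r => y + 1 - r) (by fun_prop) measurable_const)
  rw [lintegral_expMeasure_one hm, ← Set.Ioc_union_Ioi_eq_Ioi hc.le,
    lintegral_union measurableSet_Ioi (Set.Ioc_disjoint_Ioi le_rfl)]
  have h1 : ENNReal.ofReal (exitMean x y - (y + x) * Real.exp (-(y + x))) ≤
      ∫⁻ r in Set.Ioc 0 (y + x), ENNReal.ofReal (Real.exp (-r)) * (ENNReal.ofReal (min r (y + x)) +
      if r < y + x ∧ y + 1 - r ≤ x - 1 then ENNReal.ofReal (exitMean x (y + 1 - r)) else 0) := by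
    rw [← integral_exitMean, intervalIntegral.integral_of_le hc.le]
    refine (ofReal_integral_le_lintegral _).trans ?_
    refine setLIntegral_mono_ae' measurableSet_Ioc ?_
    filter_upwards [(Set.countable_singleton (y + x)).ae_notMem volume] with r hr0 hr
    have hr' : r < y + x := lt_of_le_of_ne hr.2 hr0
    rw [ENNReal.ofReal_mul (Real.exp_pos _).le, min_eq_left hr.2]
    gcongr
    split_ifs with h
    · exact ENNReal.ofReal_add_le
    · rw [add_zero]
      refine ENNReal.ofReal_le_ofReal ?_
      have h2 : x - 1 < y + 1 - r := by
        by_contra hcon; exact h ⟨hr', not_lt.1 hcon⟩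
      -- For `z = y + 1 - r`, `exitMean x z = -(z - (x - 1)) * (z + x)`, and both factors in
      -- parentheses are positive because `x - 1 < z` and `r < y + x`.
      unfold exitMean
      nlinarith
  have h2 : ENNReal.ofReal ((y + x) * Real.exp (-(y + x))) ≤
      ∫⁻ r in Set.Ioi (y + x), ENNReal.ofReal (Real.exp (-r)) * (ENNReal.ofReal (min r (y + x)) +
      if r < y + x ∧ y + 1 - r ≤ x - 1 then ENNReal.ofReal (exitMean x (y + 1 - r)) else 0) := by
    rw [← integral_exp_neg_Ioi, ← integral_const_mul]
    refine (ofReal_integral_le_lintegral _).trans ?_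
    refine setLIntegral_mono' measurableSet_Ioi fun r hr => ?_
    rw [min_eq_right (le_of_lt hr), mul_comm, ENNReal.ofReal_mul (Real.exp_pos _).le]
    gcongr
    exact le_self_add
  calc ENNReal.ofReal (exitMean x y)
      = ENNReal.ofReal ((exitMean x y - (y + x) * Real.exp (-(y + x))) +
        (y + x) * Real.exp (-(y + x))) := by rw [sub_add_cancel]
    _ ≤ _ := ENNReal.ofReal_add_le
    _ ≤ _ := add_le_add h1 h2

section

variable {Ω : Type*} {H : MeasurableSpace Ω} {mΩ : MeasurableSpace Ω} {P : Measure Ω}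
  [IsProbabilityMeasure P]

theorem lintegral_of_indep {β : Type*} [MeasurableSpace β] (hH : H ≤ mΩ)
    {Z : Ω → β} (hZ : Measurable[H] Z) {X : Ω → ℝ} (hX : Measurable X)
    (hind : Indep H (MeasurableSpace.comap X inferInstance) P)
    {F : β × ℝ → ℝ≥0∞} (hF : Measurable F) :
    ∫⁻ ω, F (Z ω, X ω) ∂P = ∫⁻ ω, ∫⁻ r, F (Z ω, r) ∂(P.map X) ∂P := by
  have hZ' : Measurable Z := hZ.mono hH le_rfl
  have h : IndepFun Z X P := indep_of_indep_of_le_left hind hZ.comap_le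
  rw [indepFun_iff_map_prod_eq_prod_map_map hZ'.aemeasurable hX.aemeasurable] at h
  have := Measure.isProbabilityMeasure_map (μ := P) hX.aemeasurable
  rw [← lintegral_map hF (hZ'.prodMk hX), h, lintegral_prod _ hF.aemeasurable,
    lintegral_map hF.lintegral_prod_right' hZ']

/-- Given an exponential variable exceeds an independent level, the excess is exponential. -/
theorem lintegral_residual {β : Type*} [MeasurableSpace β] (hH : H ≤ mΩ)
    {e : Ω → ℝ≥0∞} {W : Ω → ℝ} {Y : Ω → β} (he : Measurable[H] e) (hW : Measurable[H] W)
    (hY : Measurable[H] Y) (hW0 : ∀ ω, 0 ≤ W ω) {X : Ω → ℝ} (hX : Measurable X)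
    (hind : Indep H (MeasurableSpace.comap X inferInstance) P) (hlaw : P.map X = expMeasure 1)
    {F : β × ℝ → ℝ≥0∞} (hF : Measurable F) :
    ∫⁻ ω, (if W ω < X ω then e ω * F (Y ω, X ω - W ω) else 0) ∂P =
      ∫⁻ ω, (if W ω < X ω then e ω * ∫⁻ r, F (Y ω, r) ∂expMeasure 1 else 0) ∂P := by
  have := isProbabilityMeasure_expMeasure one_pos
  have hZ : Measurable[H] fun ω => (e ω, W ω, Y ω) := he.prodMk (hW.prodMk hY)
  have hset : MeasurableSet {p : (ℝ≥0∞ × ℝ × β) × ℝ | p.1.2.1 < p.2} :=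
    measurableSet_lt (by fun_prop) (by fun_prop)
  have h1 := lintegral_of_indep (P := P) hH hZ hX hind
    (F := fun p => if p.1.2.1 < p.2 then p.1.1 * F (p.1.2.2, p.2 - p.1.2.1) else 0)
    (Measurable.ite hset (by fun_prop) measurable_const)
  have h2 := lintegral_of_indep (P := P) hH hZ hX hind
    (F := fun p => if p.1.2.1 < p.2 then p.1.1 * ∫⁻ r, F (p.1.2.2, r) ∂expMeasure 1 else 0)
    (Measurable.ite hset (Measurable.mul (by fun_prop)
      (hF.lintegral_prod_right'.comp (by fun_prop))) measurable_const)
  dsimp only at h1 h2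
  rw [h1, h2, hlaw]
  -- With the past frozen, both sides carry the same factor `exp (-W)` by memorylessness.
  refine lintegral_congr fun ω => ?_
  have h3 := lintegral_expMeasure_shift (F := fun r => e ω * F (Y ω, r)) (by fun_prop) (hW0 ω)
  have h4 := lintegral_expMeasure_shift
    (F := fun _ => e ω * ∫⁻ r, F (Y ω, r) ∂expMeasure 1) measurable_const (hW0 ω)
  rw [h3, h4, lintegral_const, measure_univ, mul_one, lintegral_const_mul _ (by fun_prop)]

end

/-- A bound for the probability that the exit takes more than one jump. -/
noncomputable def stayProb (x : ℝ) : ℝ≥0∞ := ENNReal.ofReal (1 - Real.exp (-(2 * x)))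

theorem stayProb_lt_one (x : ℝ) : stayProb x < 1 := by
  rw [stayProb, ENNReal.ofReal_lt_one]
  linarith [Real.exp_pos (-(2 * x))]

/-- From any level up to `x - 1`, staying requires a jump before `y + x < 2 * x`; the resulting
bound is uniform in `y`. -/
theorem lintegral_stay_le {x y : ℝ} (hx : 1 ≤ x) (hy : y ≤ x - 1) :
    ∫⁻ r, (if r < y + x ∧ y + 1 - r ≤ x - 1 then 1 else 0) ∂expMeasure 1 ≤ stayProb x := by
  refine le_trans ?_ (expMeasure_one_Iio_le (t := 2 * x) (by linarith))
  rw [← lintegral_indicator_one measurableSet_Iio]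
  refine lintegral_mono fun r => ?_
  split_ifs with h
  · rw [Set.indicator_of_mem (show r ∈ Set.Iio (2 * x) by simp only [Set.mem_Iio]; linarith [h.1])]
    rfl
  · exact zero_le

theorem exitMean_le {x y : ℝ} : exitMean x y ≤ x * (x - 1) + 1 := by
  unfold exitMean
  nlinarith [sq_nonneg (y + 1 / 2)]

section

variable {Ω : Type*} {mΩ : MeasurableSpace Ω} {P : Measure Ω} [IsProbabilityMeasure P]

/-- A lower bound for the mean truncated exit time, if the first time until a jump is the residual
of an exponential variable that exceeds a level determined by the past. -/
theorem lintegral_exitMean_le {x : ℝ} (hx : 1 ≤ x) {R : ℕ → Ω → ℝ} (hR : ∀ n, Measurable[mΩ] (R n))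
    {H : ℕ → MeasurableSpace Ω} (hH : ∀ n, H n ≤ mΩ) (hmono : Monotone H)
    (hRH : ∀ n, Measurable[H (n + 1)] (R n))
    (hind : ∀ n, Indep (H n) (MeasurableSpace.comap (R n) inferInstance) P)
    (hlaw : ∀ n, P.map (R n) = expMeasure 1) (k : ℕ) :
    ∀ (n : ℕ) (e : Ω → ℝ≥0∞) (W Y : Ω → ℝ), Measurable[H n] e → Measurable[H n] W →
      Measurable[H n] Y → (∀ ω, 0 ≤ W ω) → (∀ ω, e ω ≠ 0 → -x < Y ω ∧ Y ω ≤ x - 1) →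
      ∫⁻ ω, (if W ω < R n ω then e ω * ENNReal.ofReal (exitMean x (Y ω)) else 0) ∂P ≤
        ∫⁻ ω, (if W ω < R n ω then e ω * exitTime x k (Y ω)
          (fun j => if j = 0 then R n ω - W ω else R (n + j) ω) else 0) ∂P +
        ENNReal.ofReal (x * (x - 1) + 1) * stayProb x ^ k *
          ∫⁻ ω, (if W ω < R n ω then e ω else 0) ∂P := by
  induction k with
  | zero =>
    intro n e W Y he hW hY hW0 heY
    refine le_trans ?_ le_add_self
    have hm : Measurable[mΩ] fun ω => if W ω < R n ω then e ω else 0 :=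
      Measurable.ite (measurableSet_lt (hW.mono (hH n) le_rfl) (hR n)) (he.mono (hH n) le_rfl)
        measurable_const
    rw [pow_zero, mul_one, ← lintegral_const_mul _ hm]
    refine lintegral_mono fun ω => ?_
    dsimp only
    split_ifs
    · rw [mul_comm]
      gcongr
      exact exitMean_le
    · exact zero_le
  | succ k ih =>
    intro n e W Y he hW hY hW0 heY
    have hpos : ∀ᵐ ω ∂P, 0 < R (n + 1) ω := by
      have h := ae_expMeasure_one_pos
      rw [← hlaw (n + 1)] at h
      exact ae_of_ae_map (hR (n + 1)).aemeasurable h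
    -- the event that the exit does not take place before or at the next jump
    let stay : ℝ → ℝ → Prop := fun y r => r < y + x ∧ y + 1 - r ≤ x - 1
    have hstay : MeasurableSet {p : ℝ × ℝ | stay p.1 p.2} :=
      (measurableSet_lt (f := fun p : ℝ × ℝ => p.2) (g := fun p => p.1 + x) (by fun_prop)
        (by fun_prop)).inter
      (measurableSet_le (f := fun p : ℝ × ℝ => p.1 + 1 - p.2) (by fun_prop) measurable_const)
    -- The weight `e'` keeps the paths that have not exited by the next jump, and `Y'` is their
    -- level there. Allowing arbitrary past-measurable weights is what lets the induction close.
    let e' : Ω → ℝ≥0∞ := fun ω =>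
      if W ω < R n ω ∧ stay (Y ω) (R n ω - W ω) then e ω else 0
    let Y' : Ω → ℝ := fun ω => Y ω + 1 - (R n ω - W ω)
    have hle : H n ≤ H (n + 1) := hmono (Nat.le_succ n)
    have hW1 := hW.mono hle le_rfl
    have hY1 := hY.mono hle le_rfl
    have he1 := he.mono hle le_rfl
    have he' : Measurable[H (n + 1)] e' := by
      have h1 : MeasurableSet[H (n + 1)] {ω | W ω < R n ω} := measurableSet_lt hW1 (hRH n)
      have h2 : MeasurableSet[H (n + 1)] {ω | stay (Y ω) (R n ω - W ω)} :=
        (hY1.prodMk ((hRH n).sub hW1)) hstay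
      exact Measurable.ite (h1.inter h2) he1 measurable_const
    have hY' : Measurable[H (n + 1)] Y' := (hY1.add_const 1).sub ((hRH n).sub hW1)
    have heY' : ∀ ω, e' ω ≠ 0 → -x < Y' ω ∧ Y' ω ≤ x - 1 := by
      intro ω hω
      have h : W ω < R n ω ∧ stay (Y ω) (R n ω - W ω) := by
        by_contra hcon; exact hω (if_neg hcon)
      exact ⟨by simp only [Y']; linarith [h.2.1], h.2.2⟩
    -- The next job has received no service yet, so its level is zero.
    have hih := ih (n + 1) e' (fun _ => 0) Y' he' measurable_const hY' (fun _ => le_rfl) heY'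
    have hdrop : ∀ f : Ω → ℝ≥0∞, ∫⁻ ω, (if 0 < R (n + 1) ω then f ω else 0) ∂P =
        ∫⁻ ω, f ω ∂P := fun f => lintegral_congr_ae (by
      filter_upwards [hpos] with ω hω; rw [if_pos hω])
    rw [hdrop, hdrop, hdrop] at hih
    let A : Ω → ℝ≥0∞ := fun ω =>
      if W ω < R n ω then e ω * ENNReal.ofReal (min (R n ω - W ω) (Y ω + x)) else 0
    have hA : Measurable[mΩ] A := by
      have h1 := he.mono (hH n) le_rfl
      have h2 := hW.mono (hH n) le_rfl
      have h3 := hY.mono (hH n) le_rfl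
      have h4 := hR n
      exact Measurable.ite (measurableSet_lt h2 h4)
        (h1.mul (((h4.sub h2).min (h3.add_const x)).ennreal_ofReal)) measurable_const
    have hF : Measurable fun p : ℝ × ℝ => ENNReal.ofReal (min p.2 (p.1 + x)) +
        if stay p.1 p.2 then ENNReal.ofReal (exitMean x (p.1 + 1 - p.2)) else 0 := by
      unfold exitMean
      exact (Measurable.ennreal_ofReal (by fun_prop)).add
        (Measurable.ite hstay (Measurable.ennreal_ofReal (by fun_prop)) measurable_const)
    have hfirst : ∫⁻ ω, (if W ω < R n ω then e ω * ENNReal.ofReal (exitMean x (Y ω)) else 0) ∂P ≤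
        ∫⁻ ω, A ω ∂P + ∫⁻ ω, e' ω * ENNReal.ofReal (exitMean x (Y' ω)) ∂P := by
      rw [← lintegral_add_left hA]
      have h := lintegral_residual (hH n) he hW hY hW0 (hR n) (hind n) (hlaw n) hF
      dsimp only at h
      calc _ ≤ _ := lintegral_mono fun ω => ?_
        _ = _ := h.symm
        _ = _ := lintegral_congr fun ω => ?_
      · dsimp only
        split_ifs
        · rcases eq_or_ne (e ω) 0 with h0 | h0
          · rw [h0, zero_mul]; exact zero_le
          · gcongr
            exact ofReal_exitMean_le_lintegral (heY ω h0).1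
        · exact le_rfl
      · simp only [A, e', Y']
        by_cases h1 : W ω < R n ω <;> by_cases h2 : stay (Y ω) (R n ω - W ω) <;>
          simp [h1, h2, mul_add]
    -- Each jump shrinks the surviving mass by the factor `stayProb x`, which makes the remainder
    -- geometric.
    have hlast : ∫⁻ ω, e' ω ∂P ≤ stayProb x * ∫⁻ ω, (if W ω < R n ω then e ω else 0) ∂P := by
      have h := lintegral_residual (F := fun p => if stay p.1 p.2 then 1 else 0) (hH n) he hW hY
        hW0 (hR n) (hind n) (hlaw n) (Measurable.ite hstay measurable_const measurable_const)
      dsimp only at h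
      have hm : Measurable[mΩ] fun ω => if W ω < R n ω then e ω else 0 :=
        Measurable.ite (measurableSet_lt (hW.mono (hH n) le_rfl) (hR n)) (he.mono (hH n) le_rfl)
          measurable_const
      rw [← lintegral_const_mul _ hm]
      calc _ = _ := lintegral_congr fun ω => ?_
        _ = _ := h
        _ ≤ _ := lintegral_mono fun ω => ?_
      · simp only [e']
        by_cases h1 : W ω < R n ω <;> by_cases h2 : stay (Y ω) (R n ω - W ω) <;> simp [h1, h2]
      · dsimp only
        split_ifs
        · rcases eq_or_ne (e ω) 0 with h0 | h0
          · rw [h0, zero_mul]; exact zero_le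
          · rw [mul_comm]
            gcongr
            exact lintegral_stay_le hx (heY ω h0).2
        · exact zero_le
    have hmain : ∫⁻ ω, A ω ∂P + ∫⁻ ω, e' ω * exitTime x k (Y' ω)
          (fun j => if j = 0 then R (n + 1) ω - 0 else R (n + 1 + j) ω) ∂P =
        ∫⁻ ω, (if W ω < R n ω then e ω * exitTime x (k + 1) (Y ω)
          (fun j => if j = 0 then R n ω - W ω else R (n + j) ω) else 0) ∂P := by
      rw [← lintegral_add_left hA]
      refine lintegral_congr fun ω => ?_
      have hseq : (fun j => if j = 0 then R (n + 1) ω - 0 else R (n + 1 + j) ω) =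
          fun j => if j + 1 = 0 then R n ω - W ω else R (n + (j + 1)) ω := by
        funext j
        rw [if_neg (Nat.succ_ne_zero j)]
        rcases eq_or_ne j 0 with rfl | hj
        · simp
        · rw [if_neg hj]; congr 1; ring
      rw [hseq]
      simp only [A, e', Y', exitTime, if_true]
      by_cases h1 : W ω < R n ω
      · by_cases h2 : stay (Y ω) (R n ω - W ω)
        · rw [if_pos h1, if_pos ⟨h1, h2⟩, if_pos h1, if_pos h2, mul_add]
        · rw [if_pos h1, if_neg fun h => h2 h.2, if_pos h1, if_neg h2, mul_add, mul_zero, zero_mul]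
      · rw [if_neg h1, if_neg fun h => h1 h.1, if_neg h1, zero_mul, zero_add]
    calc _ ≤ _ := hfirst
      _ ≤ _ := add_le_add_right hih _
      _ = _ := by rw [← add_assoc, hmain]
      _ ≤ _ := by
        rw [pow_succ, ← mul_assoc, mul_assoc _ (stayProb x)]
        gcongr

end

/-! ### The interval between messages lasts at least as long as the exit time -/

theorem encard_Iio (n : ℕ) : (Set.Iio n).encard = n := by
  rw [← Finset.coe_Iio, Set.encard_coe_eq_coe_finsetCard, Nat.card_Iio]

/-- If at time `u` the number of renewals with interarrival times `r` differs by at least `x` from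
the integer part of `u`, then the exit has taken place. -/
theorem exitTime_le {r : ℕ → ℝ} (hr : ∀ j, 0 ≤ r j) {x : ℕ} (hx : 1 ≤ x) {u : ℝ}
    (hu : (x : ℕ∞) ≤ absDiff {j | ∑ l ∈ Finset.range (j + 1), r l ≤ u}.encard
      {j : ℕ | (j : ℝ) + 1 ≤ u}.encard) (k : ℕ) :
    ∀ j : ℕ, ∑ l ∈ Finset.range j, r l ≤ u → (j : ℝ) - ∑ l ∈ Finset.range j, r l ≤ (x : ℝ) - 1 →
      ENNReal.ofReal (∑ l ∈ Finset.range j, r l) +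
        exitTime x k (j - ∑ l ∈ Finset.range j, r l) (fun l => r (j + l)) ≤ ENNReal.ofReal u := by
  have hmono : Monotone fun j => ∑ l ∈ Finset.range j, r l :=
    monotone_nat_of_le_succ fun j => by rw [Finset.sum_range_succ]; linarith [hr j]
  have hS0 : ∀ j, 0 ≤ ∑ l ∈ Finset.range j, r l := fun j => Finset.sum_nonneg fun l _ => hr l
  induction k with
  | zero =>
    intro j hj _
    simp only [exitTime, add_zero]
    exact ENNReal.ofReal_le_ofReal hj
  | succ k ih =>
    intro j hj hjx
    have hsucc : ∑ l ∈ Finset.range (j + 1), r l = ∑ l ∈ Finset.range j, r l + r j :=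
      Finset.sum_range_succ _ _
    have h0 := hS0 j
    rcases lt_or_ge u (∑ l ∈ Finset.range (j + 1), r l) with hlt | hge
    -- Exactly `j` renewals have occurred by `u`, so the trigger must come from below.
    · have hN : {j | ∑ l ∈ Finset.range (j + 1), r l ≤ u} = Set.Iio j := by
        ext l
        simp only [Set.mem_ofPred_eq, Set.mem_Iio]
        constructor
        · intro h
          by_contra hcon
          exact absurd (hlt.trans_le ((hmono (by omega : j + 1 ≤ l + 1)).trans h)) (lt_irrefl _)
        · intro h
          exact (hmono (by omega : l + 1 ≤ j)).trans hj
      rw [hN, encard_Iio] at hu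
      have hjxu : (j : ℝ) + x ≤ u := by
        rcases le_max_iff.1 hu with h | h
        -- The level after the `j`-th jump is at most `x - 1`, so at least `j - x + 1` integers have
        -- passed by `u` and the surplus of renewals is below `x`.
        · exfalso
          have hxj : x ≤ j := by exact_mod_cast h.trans tsub_le_self
          have h1 : ((j - x + 1 : ℕ) : ℕ∞) ≤ {j : ℕ | (j : ℝ) + 1 ≤ u}.encard := by
            rw [← encard_Iio]
            refine Set.encard_le_encard fun l hl => ?_
            have h2 : ((l + 1 : ℕ) : ℝ) ≤ ((j - x + 1 : ℕ) : ℝ) := by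
              exact_mod_cast (Set.mem_Iio.1 hl)
            push_cast [Nat.cast_sub hxj] at h2
            simp only [Set.mem_ofPred_eq]
            linarith
          have h2 : (x : ℕ∞) ≤ ((j - (j - x + 1) : ℕ) : ℕ∞) := by
            rw [ENat.natCast_sub]
            exact h.trans (tsub_le_tsub_left h1 _)
          have : x ≤ j - (j - x + 1) := by exact_mod_cast h2
          omega
        -- If `u < j + x`, at most `j + x - 1` integers have passed, a deficit below `x`. Hence `u ≥
        -- j + x`, when the level is at or below `-x`.
        · by_contra hcon
          have h1 : {j : ℕ | (j : ℝ) + 1 ≤ u} ⊆ Set.Iio (j + x - 1) := by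
            intro l hl
            have h2 : (l : ℝ) + 1 < j + x := lt_of_le_of_lt hl (not_le.1 hcon)
            have h3 : l + 1 < j + x := by exact_mod_cast h2
            simp only [Set.mem_Iio]; omega
          have h2 := Set.encard_le_encard h1
          rw [encard_Iio] at h2
          have h3 := h.trans (tsub_le_tsub_right h2 _)
          rw [← ENat.natCast_sub] at h3
          have h4 : x ≤ j + x - 1 - j := by exact_mod_cast h3
          omega
      have hrj : (j : ℝ) - ∑ l ∈ Finset.range j, r l + x < r (j + 0) := by
        rw [add_zero]; linarith
      simp only [exitTime]
      rw [if_neg fun h => absurd h.1 (not_lt.2 hrj.le), add_zero, min_eq_right hrj.le]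
      rcases le_total 0 ((j : ℝ) - ∑ l ∈ Finset.range j, r l + x) with h1 | h1
      · rw [← ENNReal.ofReal_add h0 h1]
        exact ENNReal.ofReal_le_ofReal (by linarith)
      · rw [ENNReal.ofReal_of_nonpos h1, add_zero]
        exact ENNReal.ofReal_le_ofReal hj
    · simp only [exitTime, add_zero]
      have hle : ENNReal.ofReal (∑ l ∈ Finset.range j, r l) +
          ENNReal.ofReal (min (r j) ((j : ℝ) - ∑ l ∈ Finset.range j, r l + x)) ≤
          ENNReal.ofReal (∑ l ∈ Finset.range (j + 1), r l) := by
        rw [hsucc, ENNReal.ofReal_add h0 (hr j)]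
        gcongr
        exact min_le_left _ _
      rw [← add_assoc]
      split_ifs with h
      · have h2 : (j : ℝ) - ∑ l ∈ Finset.range j, r l + 1 - r j =
            ((j + 1 : ℕ) : ℝ) - ∑ l ∈ Finset.range (j + 1), r l := by
          rw [hsucc]; push_cast; ring
        have h3 : (fun l => r (j + (l + 1))) = fun l => r (j + 1 + l) := by
          funext l; congr 1; ring
        rw [h2, h3]
        exact (add_le_add_left hle _).trans (ih (j + 1) hge (h2 ▸ h.2))
      · rw [add_zero]
        exact hle.trans (ENNReal.ofReal_le_ofReal hge)

theorem countUpTo_eq_add {d : ℕ → ℝ≥0∞} {n : ℕ} {t : ℝ≥0∞}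
    (h : ∀ j < n, d j ≤ t) : countUpTo d t = n + {j | d (n + j) ≤ t}.encard := by
  have h1 : {j | d j ≤ t} = Set.Iio n ∪ (fun j => n + j) '' {j | d (n + j) ≤ t} := by
    ext j
    simp only [Set.mem_ofPred_eq, Set.mem_union, Set.mem_Iio, Set.mem_image]
    constructor
    · intro hj
      rcases lt_or_ge j n with hjn | hjn
      · exact Or.inl hjn
      · exact Or.inr ⟨j - n, by rwa [Nat.add_sub_cancel' hjn], Nat.add_sub_cancel' hjn⟩
    · rintro (hj | ⟨l, hl, rfl⟩)
      · exact h j hj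
      · exact hl
  rw [countUpTo, h1, Set.encard_union_eq, encard_Iio, (add_right_injective n).encard_image]
  rw [Set.disjoint_left]
  rintro _ hj ⟨l, -, rfl⟩
  simp only [Set.mem_Iio] at hj
  omega

theorem countUpTo_eq_iff {d : ℕ → ℝ≥0∞} (hd : Monotone d) {n : ℕ} {t : ℝ≥0∞} :
    countUpTo d t = n ↔ (∀ j < n, d j ≤ t) ∧ t < d n := by
  constructor
  · intro h
    have h1 : ∀ j < n, d j ≤ t := by
      intro j hj
      by_contra hcon
      have h2 : {l | d l ≤ t} ⊆ Set.Iio j := fun l hl => by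
        by_contra hlj
        exact hcon ((hd (not_lt.1 hlj)).trans hl)
      have h3 := Set.encard_le_encard h2
      rw [encard_Iio] at h3
      rw [countUpTo] at h
      rw [h] at h3
      have : n ≤ j := by exact_mod_cast h3
      omega
    refine ⟨h1, ?_⟩
    by_contra hcon
    have h2 : ∀ j < n + 1, d j ≤ t := fun j hj =>
      (hd (Nat.lt_succ_iff.1 hj)).trans (not_lt.1 hcon)
    have h3 : ((n + 1 : ℕ) : ℕ∞) ≤ countUpTo d t := by
      rw [countUpTo_eq_add h2]; exact le_self_add
    rw [h] at h3
    have : n + 1 ≤ n := by exact_mod_cast h3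
    omega
  · rintro ⟨h1, h2⟩
    rw [countUpTo_eq_add h1]
    have : {j | d (n + j) ≤ t} = ∅ := by
      ext j
      simp only [Set.mem_ofPred_eq, Set.mem_empty_iff_false, iff_false, not_le]
      exact h2.trans_le (hd (Nat.le_add_right n j))
    rw [this, Set.encard_empty, add_zero]

theorem serve_zero_const (s : ℝ≥0) (j : ℕ) :
    serve (fun _ => 0) (fun _ => s) j = ((j + 1) * s : ℝ≥0) := by
  induction j with
  | zero => simp [serve]
  | succ j ih =>
    rw [serve, ih, max_eq_right zero_le]
    push_cast
    ring

namespace ServerInput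

variable {V : ServerInput}

theorem depTime_mono : Monotone V.depTime := serve_mono _ _

theorem departures_eq_iff {n : ℕ} {t : ℝ≥0} :
    V.departures t = n ↔ (∀ j < n, V.depTime j ≤ t) ∧ t < V.depTime n := by
  rw [departures_eq, countUpTo_eq_iff depTime_mono]

theorem queueLength_eq_top_iff {t : ℝ≥0} (h : V.departures t ≠ ⊤) :
    V.queueLength t = ⊤ ↔ ∀ j, V.arrTime j ≤ t := by
  simp only [arrTime_le_iff]
  rw [queueLength, ENat.sub_eq_top_iff, and_iff_left h]
  constructor
  · intro h j; rw [h]; exact ENat.natCast_lt_top j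
  · intro h
    rw [ENat.eq_top_iff_forall_gt]
    exact h

/-- The (scaled) times between departures after time `t₀`, if `n` jobs have departed by `t₀` and
the queue is infinite from then on. -/
noncomputable def residuals (V : ServerInput) (μ t₀ : ℝ≥0) (n : ℕ) (j : ℕ) : ℝ :=
  if j = 0 then μ * V.requirement n - μ * (t₀ - (startTime V.arrTime V.depTime n).toReal)
  else μ * V.requirement (n + j)

theorem startTime_le {n : ℕ} {t : ℝ≥0∞} (ha : ∀ j, V.arrTime j ≤ t)
    (hd : ∀ j < n, V.depTime j ≤ t) : startTime V.arrTime V.depTime n ≤ t := by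
  cases n with
  | zero => exact ha 0
  | succ n => exact max_le (ha _) (hd n (Nat.lt_succ_self n))

/-- All jobs are present at `t₀`, so the server never idles afterwards, and departures are spaced by
full requirements except for the remaining part of the job in service. -/
theorem depTime_eq_residuals {μ t₀ : ℝ≥0} (hμ : 0 < μ) {n : ℕ} (hn : V.departures t₀ = n)
    (ha : ∀ j, V.arrTime j ≤ t₀) (l : ℕ) :
    V.depTime (n + l) = ENNReal.ofReal
      (t₀ + (∑ j ∈ Finset.range (l + 1), V.residuals μ t₀ n j) / μ) := by
  have hμ' : (0 : ℝ) < μ := hμ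
  obtain ⟨hd, hlt⟩ := departures_eq_iff.1 hn
  have hb := startTime_le ha hd
  induction l with
  | zero =>
    rw [add_zero, depTime, serve_eq_startTime_add]
    change startTime V.arrTime V.depTime n + _ = _
    simp only [zero_add, Finset.sum_range_one, residuals, if_true]
    lift startTime V.arrTime V.depTime n to ℝ≥0 using ne_top_of_le_ne_top ENNReal.coe_ne_top hb
      with b
    rw [ENNReal.coe_toReal, ← ENNReal.coe_add, ← ENNReal.ofReal_coe_nnreal]
    congr 1
    push_cast
    field_simp
    ring
  | succ l ih =>
    have h1 : V.arrTime (n + l + 1) ≤ V.depTime (n + l) :=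
      (ha _).trans (hlt.le.trans (depTime_mono (Nat.le_add_right n l)))
    have h2 : V.depTime (n + (l + 1)) = V.depTime (n + l) + V.requirement (n + (l + 1)) := by
      change max (V.arrTime (n + l + 1)) (V.depTime (n + l)) + _ = _
      rw [max_eq_right h1]; rfl
    have h3 : (t₀ : ℝ≥0∞) ≤ V.depTime (n + l) := hlt.le.trans (depTime_mono (Nat.le_add_right n l))
    -- Additivity of `ENNReal.ofReal` needs this sign; a negative value would be truncated to
    -- departure time zero, contradicting a departure after `t₀`.
    have h4 : 0 ≤ (t₀ : ℝ) + (∑ j ∈ Finset.range (l + 1), V.residuals μ t₀ n j) / μ := by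
      by_contra hcon
      rw [ih, ENNReal.ofReal_of_nonpos (not_le.1 hcon).le, nonpos_iff_eq_zero] at h3
      have h5 : V.depTime n ≤ V.depTime (n + l) := depTime_mono (Nat.le_add_right n l)
      rw [ih, ENNReal.ofReal_of_nonpos (not_le.1 hcon).le] at h5
      exact absurd (lt_of_lt_of_le hlt h5) (by simp)
    rw [h2, ih, ← ENNReal.ofReal_coe_nnreal, ← ENNReal.ofReal_add h4 NNReal.zero_le_coe,
      Finset.sum_range_succ _ (l + 1)]
    congr 1
    simp only [residuals, Nat.succ_ne_zero, if_false]
    field_simp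
    ring

/-- Under backlog every emulated job arrives at emulated time zero, so in units of `1 / μ` the
emulated departures are the positive integers. -/
theorem emuError_eq_renewal {μ t₀ t : ℝ≥0} (hμ : 0 < μ) {n : ℕ} (hn : V.departures t₀ = n)
    (ha : ∀ j, V.arrTime j ≤ t₀) (ht : t₀ ≤ t) :
    V.emuError μ t₀ t = absDiff
      {j | ∑ l ∈ Finset.range (j + 1), V.residuals μ t₀ n l ≤ μ * ((t : ℝ) - t₀)}.encard
      {j : ℕ | (j : ℝ) + 1 ≤ μ * ((t : ℝ) - t₀)}.encard := by
  have hμ' : (0 : ℝ) < μ := hμ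
  obtain ⟨hd, hlt⟩ := departures_eq_iff.1 hn
  have hfin : V.departures t₀ ≠ ⊤ := by rw [hn]; exact ENat.natCast_ne_top n
  have h1 : V.departures t = n + {j | V.depTime (n + j) ≤ t}.encard := by
    rw [departures_eq, countUpTo_eq_add fun j hj =>
      (hd j hj).trans (ENNReal.coe_le_coe.2 ht)]
  have h2 : (fun j => V.arrTime ((V.departures t₀).toNat + j) - t₀) = fun _ => 0 :=
    funext fun j => tsub_eq_zero_of_le (ha _)
  rw [emuError, emuDepartures_eq_countUpTo μ hfin, h2, h1, hn,
    (ENat.addLECancellable_natCast n).add_tsub_cancel_left, countUpTo]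
  congr 2
  · ext j
    simp only [Set.mem_ofPred_eq]
    rw [depTime_eq_residuals hμ hn ha, ← ENNReal.ofReal_coe_nnreal,
      ENNReal.ofReal_le_ofReal_iff NNReal.zero_le_coe, ← le_sub_iff_add_le', div_le_iff₀ hμ',
      mul_comm]
  · ext j
    simp only [Set.mem_ofPred_eq]
    rw [serve_zero_const, ENNReal.coe_le_coe, ← NNReal.coe_le_coe, NNReal.coe_sub ht]
    push_cast
    rw [← div_eq_mul_inv, div_le_iff₀ hμ', mul_comm]

theorem residuals_nonneg {μ t₀ : ℝ≥0} {n : ℕ} (hn : V.departures t₀ = n)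
    (ha : ∀ j, V.arrTime j ≤ t₀) (j : ℕ) : 0 ≤ V.residuals μ t₀ n j := by
  obtain ⟨hd, hlt⟩ := departures_eq_iff.1 hn
  have hb := startTime_le ha hd
  rw [residuals]
  split_ifs
  · rw [depTime, serve_eq_startTime_add] at hlt
    change (t₀ : ℝ≥0∞) < startTime V.arrTime V.depTime n + _ at hlt
    lift startTime V.arrTime V.depTime n to ℝ≥0 using ne_top_of_le_ne_top ENNReal.coe_ne_top hb
      with b
    have h1 : t₀ < b + V.requirement n := by exact_mod_cast hlt
    have h2 : (t₀ : ℝ) < b + V.requirement n := by exact_mod_cast h1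
    rw [ENNReal.coe_toReal, ← mul_sub]
    exact mul_nonneg NNReal.zero_le_coe (by linarith)
  · positivity

theorem exitTime_le_intervalDuration {μ : ℝ≥0} (hμ : 0 < μ) {x m n : ℕ} (hx : 1 ≤ x) {t₀ : ℝ≥0}
    (hT : V.msgTime μ x m = t₀) (hn : V.departures t₀ = n) (ha : ∀ j, V.arrTime j ≤ t₀)
    (k : ℕ) : exitTime x k 0 (V.residuals μ t₀ n) ≤ μ * V.intervalDuration μ x m := by
  have hμ' : (μ : ℝ≥0∞) ≠ 0 := by simpa using hμ.ne'
  rw [← ENNReal.div_le_iff' hμ' ENNReal.coe_ne_top, intervalDuration, hT]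
  refine ENNReal.le_sub_of_add_le_right ENNReal.coe_ne_top (le_iInf₂ fun t ht => ?_)
  obtain ⟨ht1, ht2⟩ := ht
  rw [hT] at ht1
  have ht0 : t₀ ≤ t := by exact_mod_cast ht1.le
  have ht0' : (t₀ : ℝ) ≤ t := ht0
  rw [hT, ENNReal.toNNReal_coe, emuError_eq_renewal hμ hn ha ht0] at ht2
  have h := exitTime_le (residuals_nonneg hn ha) hx ht2 k 0
    (by simp only [Finset.range_zero, Finset.sum_empty]
        exact mul_nonneg NNReal.zero_le_coe (by linarith))
    (by simp only [Finset.range_zero, Finset.sum_empty]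
        have : (1 : ℝ) ≤ x := by exact_mod_cast hx
        push_cast; linarith)
  simp only [Finset.range_zero, Finset.sum_empty, ENNReal.ofReal_zero, zero_add, Nat.cast_zero,
    sub_zero] at h
  calc exitTime x k 0 (V.residuals μ t₀ n) / μ + t₀
      ≤ (t - t₀ : ℝ≥0) + t₀ := by
        gcongr
        rw [ENNReal.div_le_iff' hμ' ENNReal.coe_ne_top, ← ENNReal.coe_mul,
          ← ENNReal.ofReal_coe_nnreal, NNReal.coe_mul, NNReal.coe_sub ht0]
        exact h
    _ = t := by rw [← ENNReal.coe_add, tsub_add_cancel_of_le ht0]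

end ServerInput

/-! ### Backlogged intervals that start after exactly `n` departures -/

section

variable {Ω : Type*} {U : MeasurableSpace Ω} {V : Ω → ServerInput} {n : ℕ}
  {α δ : ℕ → Ω → ℝ≥0∞}

/-- The paths on which the `m`-th message finds an infinite backlog after exactly `n` departures. -/
def backloggedAfter (V : Ω → ServerInput) (μ : ℝ≥0) (x m n : ℕ) : Set Ω :=
  {ω | ω ∈ regularPaths V ∧ (V ω).StartsBacklogged μ x m ∧
    (V ω).departures ((V ω).msgTime μ x m).toNNReal = n}

/-- The event that, judging from the past before the `n`-th departure, the `m`-th message finds an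
infinite backlog and at least `n` departures. -/
def pastBacklogged (μ : ℝ≥0) (x m n : ℕ) (α δ : ℕ → Ω → ℝ≥0∞) : Set Ω :=
  {ω | (∀ j < n, δ j ω ≤ seqMsgTime μ x (fun j => α j ω) (fun j => δ j ω) m) ∧
    (∀ j, α j ω ≤ seqMsgTime μ x (fun j => α j ω) (fun j => δ j ω) m) ∧
    seqMsgTime μ x (fun j => α j ω) (fun j => δ j ω) m < ∞}

theorem measurableSet_pastBacklogged {Ω : Type*} [MeasurableSpace Ω] {α δ : ℕ → Ω → ℝ≥0∞}
    (hα : ∀ j, Measurable (α j)) (hδ : ∀ j, Measurable (δ j)) (μ : ℝ≥0) (x m n : ℕ) :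
    MeasurableSet (pastBacklogged μ x m n α δ) := by
  have hT := measurable_seqMsgTime μ x hα hδ m
  have h1 : MeasurableSet {ω | ∀ j < n, δ j ω ≤
      seqMsgTime μ x (fun j => α j ω) (fun j => δ j ω) m} := by
    simp only [Set.ofPred_forall]
    exact MeasurableSet.iInter fun j => MeasurableSet.iInter fun _ => measurableSet_le (hδ j) hT
  have h2 : MeasurableSet {ω | ∀ j, α j ω ≤
      seqMsgTime μ x (fun j => α j ω) (fun j => δ j ω) m} := by
    simp only [Set.ofPred_forall]
    exact MeasurableSet.iInter fun j => measurableSet_le (hα j) hT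
  exact h1.inter (h2.inter (measurableSet_lt hT measurable_const))

namespace IsPastVersion

variable {μ : ℝ≥0} {x m : ℕ} {ω : Ω}

theorem depTime_eq (hv : IsPastVersion U V n α δ) (hω : ω ∈ regularPaths V) : (V ω).depTime n =
    startTime (fun j => α j ω) (fun j => δ j ω) n + (V ω).requirement n := by
  rw [← startTime_eq_of_version hv.arr_eq hv.dep_eq_of_lt hω]
  exact serve_eq_startTime_add _ _ _

theorem min_msgTime_eq (hv : IsPastVersion U V n α δ) (hμ : 0 < μ)
    (hω : ω ∈ regularPaths V) :
    min ((V ω).msgTime μ x m) ((V ω).depTime n) =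
    min (seqMsgTime μ x (fun j => α j ω) (fun j => δ j ω) m) ((V ω).depTime n) := by
  rw [ServerInput.msgTime_eq_seqMsgTime hω.2 hμ]
  exact min_seqMsgTime_congr (hv.arr_eq ω hω) (hv.dep_eq ω hω) m

/-- The version of the past identifies the events on which a message finds an infinite backlog. -/
theorem mem_backloggedAfter_iff (hv : IsPastVersion U V n α δ) (hμ : 0 < μ)
    (hω : ω ∈ regularPaths V) :
    ω ∈ backloggedAfter V μ x m n ↔
    ω ∈ pastBacklogged μ x m n α δ ∧
      seqMsgTime μ x (fun j => α j ω) (fun j => δ j ω) m < (V ω).depTime n := by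
  have hmin := hv.min_msgTime_eq hμ (x := x) (m := m) hω
  have hfin := ServerInput.departures_ne_top hω.2
  -- Equal capped values agree without the cap once one of them lies strictly below it.
  have hlt_left : ∀ {a b c : ℝ≥0∞}, min a c = min b c → a < c → a = b := by
    intro a b c h hac
    rw [min_eq_left hac.le] at h
    rcases min_choice b c with h1 | h1
    · rw [h, h1]
    · rw [h1] at h; exact absurd h hac.ne
  constructor
  · rintro ⟨-, ⟨hT, hQ⟩, hD⟩
    rw [ServerInput.queueLength_eq_top_iff (hfin _)] at hQ
    rw [ServerInput.departures_eq_iff] at hD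
    simp only [ENNReal.coe_toNNReal hT.ne] at hQ hD
    have heq := hlt_left hmin hD.2
    simp only [pastBacklogged, Set.mem_ofPred_eq]
    rw [← heq]
    refine ⟨⟨fun j hj => ?_, fun j => ?_, hT⟩, hD.2⟩
    · rw [← hv.dep_eq_of_lt ω hω j hj]; exact hD.1 j hj
    · rw [← hlt_left (hv.arr_eq ω hω j) ((hQ j).trans_lt hD.2)]; exact hQ j
  · rintro ⟨⟨h1, h2, h3⟩, h4⟩
    have heq := hlt_left hmin.symm h4
    rw [heq] at h1 h2 h3 h4
    refine ⟨hω, ⟨h3, ?_⟩, ?_⟩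
    · rw [ServerInput.queueLength_eq_top_iff (hfin _), ENNReal.coe_toNNReal h3.ne]
      intro j
      rw [← hlt_left (hv.arr_eq ω hω j).symm ((h2 j).trans_lt h4)]
      exact h2 j
    · rw [ServerInput.departures_eq_iff, ENNReal.coe_toNNReal h3.ne]
      refine ⟨fun j hj => ?_, h4⟩
      rw [hv.dep_eq_of_lt ω hω j hj]; exact h1 j hj

theorem msgTime_eq (hv : IsPastVersion U V n α δ) (hμ : 0 < μ)
    (hω : ω ∈ regularPaths V)
    (h : ω ∈ backloggedAfter V μ x m n) :
    (V ω).msgTime μ x m = seqMsgTime μ x (fun j => α j ω) (fun j => δ j ω) m := by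
  have hmin := hv.min_msgTime_eq hμ (x := x) (m := m) hω
  have h4 := ((hv.mem_backloggedAfter_iff hμ hω).1 h).2
  rw [min_eq_left h4.le] at hmin
  rcases min_choice ((V ω).msgTime μ x m) ((V ω).depTime n) with h1 | h1
  · rw [← hmin, h1]
  · rw [h1] at hmin; exact absurd hmin h4.ne'

end IsPastVersion

end

/-! ### Regular paths and the bound for a fixed number of departures -/

section

variable {Ω : Type*} {U : MeasurableSpace Ω} {mΩ : MeasurableSpace Ω} {P : Measure Ω}
  {V : Ω → ServerInput} {μ : ℝ≥0}

theorem measurableSet_regularPaths (hreq : ∀ j, Measurable[mΩ] fun ω => (V ω).requirement j) :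
    MeasurableSet[mΩ] (regularPaths V) := by
  have h1 : MeasurableSet[mΩ] {ω | ∀ j, 0 < (V ω).requirement j} := by
    simp only [Set.ofPred_forall]
    exact MeasurableSet.iInter fun j => measurableSet_lt measurable_const (hreq j)
  have h2 : Measurable[mΩ] fun ω => ∑' j, ((V ω).requirement j : ℝ≥0∞) :=
    Measurable.tsum fun j => measurable_coe_nnreal_ennreal.comp (hreq j)
  exact h1.inter (h2 (measurableSet_singleton ∞))

theorem map_mul_requirement (hμ : 0 < μ)
    (hreq : ∀ j, Measurable[mΩ] fun ω => (V ω).requirement j)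
    (hexp : ∀ j, P.map (fun ω => ((V ω).requirement j : ℝ)) = expMeasure μ) (j : ℕ) :
    P.map (fun ω => (μ : ℝ) * (V ω).requirement j) = expMeasure 1 := by
  rw [← expMeasure_map_mul (show (0 : ℝ) < μ from hμ), ← hexp j,
    Measure.map_map (g := fun r : ℝ => (μ : ℝ) * r) (f := fun ω => ((V ω).requirement j : ℝ))
      (by fun_prop) (measurable_coe_nnreal_real.comp (hreq j))]
  rfl

/-- Averages of a summable sequence tend to zero, while the strong law gives the positive limit
`μ⁻¹`. -/
theorem ae_mem_regularPaths (hμ : 0 < μ)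
    (hreq : ∀ j, Measurable[mΩ] fun ω => (V ω).requirement j)
    (hmean : ∀ j, ∫⁻ ω, ((V ω).requirement j : ℝ≥0∞) ∂P = (μ⁻¹ : ℝ≥0))
    (hexp : ∀ j, P.map (fun ω => ((V ω).requirement j : ℝ)) = expMeasure μ)
    (hindep : iIndepFun (fun j ω => (V ω).requirement j) P) : ∀ᵐ ω ∂P, ω ∈ regularPaths V := by
  have hμ' : (0 : ℝ) < μ := hμ
  have hm : ∀ j, Measurable[mΩ] fun ω => ((V ω).requirement j : ℝ) := fun j =>
    measurable_coe_nnreal_real.comp (hreq j)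
  have hpos : ∀ᵐ ω ∂P, ∀ j, 0 < (V ω).requirement j := by
    rw [ae_all_iff]
    intro j
    have h := ae_expMeasure_one_pos
    rw [← map_mul_requirement hμ hreq hexp j] at h
    filter_upwards [ae_of_ae_map ((hm j).const_mul _).aemeasurable h] with ω hω
    have := pos_of_mul_pos_right hω hμ'.le
    exact_mod_cast this
  have hint : Integrable (fun ω => ((V ω).requirement 0 : ℝ)) P := by
    refine ⟨(hm 0).aestronglyMeasurable, ?_⟩
    rw [hasFiniteIntegral_iff_enorm]
    simp only [Real.enorm_eq_ofReal NNReal.zero_le_coe, ENNReal.ofReal_coe_nnreal]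
    rw [hmean]; exact ENNReal.coe_lt_top
  have hmean' : ∫ ω, ((V ω).requirement 0 : ℝ) ∂P = (μ : ℝ)⁻¹ := by
    rw [integral_eq_lintegral_of_nonneg_ae (Filter.Eventually.of_forall fun _ =>
      NNReal.zero_le_coe) (hm 0).aestronglyMeasurable]
    simp only [ENNReal.ofReal_coe_nnreal]
    rw [hmean]; simp
  have hslln := strong_law_ae_real (fun j ω => ((V ω).requirement j : ℝ)) hint
    (fun j k hjk => (hindep.indepFun hjk).comp measurable_coe_nnreal_real
      measurable_coe_nnreal_real)
    (fun j => ⟨(hm j).aemeasurable, (hm 0).aemeasurable, by rw [hexp, hexp]⟩)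
  filter_upwards [hpos, hslln] with ω h1 h2
  refine ⟨h1, ?_⟩
  rw [hmean'] at h2
  by_contra hne
  have hs : Summable fun j => (V ω).requirement j := ENNReal.tsum_coe_ne_top_iff_summable.1 hne
  have hs' : Summable fun j => ((V ω).requirement j : ℝ) := NNReal.summable_coe.2 hs
  have h3 := hs'.hasSum.tendsto_sum_nat.div_atTop tendsto_natCast_atTop_atTop
  exact (inv_pos.2 hμ').ne' (tendsto_nhds_unique h2 h3)

variable [IsProbabilityMeasure P]

/-- The bound for the mean interval between messages, given the number of departures before. -/
theorem lintegral_backloggedAfter (hU : U ≤ mΩ) (hμ : 0 < μ)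
    (hreq : ∀ j, Measurable[mΩ] fun ω => (V ω).requirement j)
    (hexp : ∀ j, P.map (fun ω => ((V ω).requirement j : ℝ)) = expMeasure μ)
    (hindep : iIndepFun (fun j ω => (V ω).requirement j) P)
    (hUindep : Indep U
      (⨆ j, MeasurableSpace.comap (fun ω => (V ω).requirement j) inferInstance) P)
    (hadapted : ∀ t, Measurable[departureSpace U V t] fun ω => (V ω).jobs t)
    (hreg : ∀ᵐ ω ∂P, ω ∈ regularPaths V) {x : ℕ} (hx : 1 ≤ x) (m n : ℕ) :
    MeasurableSet[mΩ] (backloggedAfter V μ x m n) ∧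
      ENNReal.ofReal ((x : ℝ) * ((x : ℝ) - 1)) * P (backloggedAfter V μ x m n) ≤
        μ * ∫⁻ ω in backloggedAfter V μ x m n, (V ω).intervalDuration μ x m ∂P := by
  classical
  have hμ' : (0 : ℝ) < μ := hμ
  have hx' : (1 : ℝ) ≤ x := by exact_mod_cast hx
  obtain ⟨α, δ, hv⟩ := exists_isPastVersion hadapted n
  have hHle := fun n => pastSpace_le (mΩ := mΩ) hU hreq n
  let T : Ω → ℝ≥0∞ := fun ω => seqMsgTime μ x (fun j => α j ω) (fun j => δ j ω) m
  let b : Ω → ℝ≥0∞ := fun ω => startTime (fun j => α j ω) (fun j => δ j ω) n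
  let E : Set Ω := pastBacklogged μ x m n α δ
  have hT : Measurable[pastSpace U V n] T :=
    @measurable_seqMsgTime _ (pastSpace U V n) μ x _ _ hv.measurable_arr hv.measurable_dep m
  have hb : Measurable[pastSpace U V n] b :=
    @measurable_startTime _ (pastSpace U V n) _ _ hv.measurable_arr hv.measurable_dep n
  have hE : MeasurableSet[pastSpace U V n] E :=
    @measurableSet_pastBacklogged _ (pastSpace U V n) _ _ hv.measurable_arr hv.measurable_dep
      μ x m n
  let R : ℕ → Ω → ℝ := fun j ω => (μ : ℝ) * (V ω).requirement j
  let e : Ω → ℝ≥0∞ := E.indicator 1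
  -- Scaled service already given to job `n` at the message; the maximum only matters off `E`, where
  -- the difference may be negative.
  let W : Ω → ℝ := fun ω => max 0 (μ * ((T ω).toReal - (b ω).toReal))
  have he : Measurable[pastSpace U V n] e := by
    have h1 : Measurable[pastSpace U V n] (1 : Ω → ℝ≥0∞) := measurable_const
    exact h1.indicator hE
  have hW : Measurable[pastSpace U V n] W :=
    (measurable_const (a := (0 : ℝ))).max
      ((hT.ennreal_toReal.sub hb.ennreal_toReal).const_mul (μ : ℝ))
  have hRmeas : ∀ {m' : MeasurableSpace Ω} (j : ℕ),
      Measurable[m'] (fun ω => (V ω).requirement j) → Measurable[m'] (R j) := fun j h =>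
    (measurable_coe_nnreal_real.comp h).const_mul _
  have hR : ∀ j, Measurable[mΩ] (R j) := fun j => hRmeas j (hreq j)
  have hbT : ∀ ω ∈ E, b ω ≤ T ω := by
    rintro ω ⟨h1, h2, -⟩
    simp only [b, T]
    cases n with
    | zero => exact h2 0
    | succ n => exact max_le (h2 _) (h1 n (Nat.lt_succ_self n))
  have hWE : ∀ ω ∈ E, W ω = μ * ((T ω).toReal - (b ω).toReal) := fun ω hω =>
    max_eq_right (mul_nonneg hμ'.le (sub_nonneg.2 (ENNReal.toReal_mono hω.2.2.ne (hbT ω hω))))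
  -- The message precedes departure `n` exactly when requirement `n` outlasts the service already
  -- given; this puts the event in the form `lintegral_exitMean_le` needs.
  have hC : ∀ ω ∈ regularPaths V,
      (ω ∈ backloggedAfter V μ x m n ↔ ω ∈ E ∧ W ω < R n ω) := by
    intro ω hω
    rw [hv.mem_backloggedAfter_iff hμ hω]
    refine and_congr_right fun hωE => ?_
    rw [hWE ω hωE, hv.depTime_eq hω]
    have hTfin : T ω ≠ ∞ := hωE.2.2.ne
    have hbfin : b ω ≠ ∞ := ne_top_of_le_ne_top hTfin (hbT ω hωE)
    change T ω < b ω + _ ↔ _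
    lift T ω to ℝ≥0 using hTfin with T'
    lift b ω to ℝ≥0 using hbfin with b'
    simp only [R, ENNReal.coe_toReal]
    rw [mul_lt_mul_iff_right₀ hμ', sub_lt_iff_lt_add']
    norm_cast
  have hCmeas : MeasurableSet[mΩ] (backloggedAfter V μ x m n) := by
    have h : backloggedAfter V μ x m n =
        regularPaths V ∩ (E ∩ {ω | W ω < R n ω}) := by
      ext ω
      exact ⟨fun h => ⟨h.1, (hC ω h.1).1 h⟩, fun h => (hC ω h.1).2 h.2⟩
    rw [h]
    exact (measurableSet_regularPaths hreq).inter ((hHle n _ hE).inter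
      (measurableSet_lt (hW.mono (hHle n) le_rfl) (hR n)))
  refine ⟨hCmeas, ?_⟩
  have hconst : ∀ c : ℝ≥0∞, ∫⁻ ω, (if W ω < R n ω then e ω * c else 0) ∂P =
      c * P (backloggedAfter V μ x m n) := by
    intro c
    rw [← lintegral_indicator_const hCmeas]
    refine lintegral_congr_ae ?_
    filter_upwards [hreg] with ω hω
    by_cases h1 : ω ∈ E <;> by_cases h2 : W ω < R n ω <;>
      simp [e, Set.indicator, hC ω hω, h1, h2]
  have key : ∀ k : ℕ, ENNReal.ofReal ((x : ℝ) * ((x : ℝ) - 1)) * P (backloggedAfter V μ x m n) ≤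
      μ * ∫⁻ ω in backloggedAfter V μ x m n, (V ω).intervalDuration μ x m ∂P +
        ENNReal.ofReal (x * (x - 1) + 1) * stayProb x ^ k * P (backloggedAfter V μ x m n) := by
    intro k
    have h := lintegral_exitMean_le (P := P) hx' hR hHle (pastSpace_mono U V)
      (fun j => hRmeas j (measurable_requirement_pastSpace U V j))
      (fun j => indep_of_indep_of_le_right (indep_pastSpace hU hreq hindep hUindep j)
        (measurable_iff_comap_le.1 (hRmeas j (comap_measurable _))))
      (map_mul_requirement hμ hreq hexp) k n e W (fun _ => 0) he hW measurable_const
      (fun ω => le_max_left _ _) (fun ω _ => ⟨by linarith, by linarith⟩)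
    have h1 := hconst 1
    simp only [mul_one, one_mul] at h1
    rw [hconst, h1] at h
    have h0 : exitMean x 0 = (x : ℝ) * ((x : ℝ) - 1) := by simp [exitMean]
    rw [h0] at h
    refine h.trans (add_le_add_left ?_ _)
    rw [← lintegral_const_mul' _ _ ENNReal.coe_ne_top, ← lintegral_indicator hCmeas]
    refine lintegral_mono_ae ?_
    filter_upwards [hreg] with ω hω
    split_ifs with h2
    · by_cases h3 : ω ∈ E
      · have hmem := (hC ω hω).2 ⟨h3, h2⟩
        rw [Set.indicator_of_mem hmem]
        have hTeq := hv.msgTime_eq hμ hω hmem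
        have hTfin : T ω ≠ ∞ := h3.2.2.ne
        obtain ⟨-, ⟨-, hQ⟩, hD⟩ := hmem
        have hseq : (fun j => if j = 0 then R n ω - W ω else R (n + j) ω) =
            (V ω).residuals μ (T ω).toNNReal n := by
          funext j
          simp only [ServerInput.residuals, R]
          rw [hWE ω h3, startTime_eq_of_version hv.arr_eq hv.dep_eq_of_lt hω]
          rfl
        rw [hseq]
        simp only [e, Set.indicator_of_mem h3, Pi.one_apply, one_mul]
        rw [hTeq] at hQ hD
        rw [ServerInput.queueLength_eq_top_iff (ServerInput.departures_ne_top hω.2 _)] at hQ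
        exact ServerInput.exitTime_le_intervalDuration hμ hx
          (by rw [hTeq, ENNReal.coe_toNNReal hTfin]) hD hQ k
      · simp only [e, Set.indicator_of_notMem h3, zero_mul]
        exact zero_le
    · exact zero_le
  have hlim : Filter.Tendsto (fun k : ℕ =>
      μ * ∫⁻ ω in backloggedAfter V μ x m n, (V ω).intervalDuration μ x m ∂P +
        ENNReal.ofReal (x * (x - 1) + 1) * stayProb x ^ k * P (backloggedAfter V μ x m n))
      Filter.atTop (nhds (μ * ∫⁻ ω in backloggedAfter V μ x m n,
        (V ω).intervalDuration μ x m ∂P + 0)) := by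
    refine tendsto_const_nhds.add ?_
    have h1 := ENNReal.tendsto_pow_atTop_nhds_zero_of_lt_one (stayProb_lt_one x)
    have h2 := ENNReal.Tendsto.const_mul (a := ENNReal.ofReal (x * (x - 1) + 1)) h1
      (Or.inr ENNReal.ofReal_ne_top)
    have h3 := ENNReal.Tendsto.mul_const (b := P (backloggedAfter V μ x m n)) h2
      (Or.inr (measure_ne_top _ _))
    simpa using h3
  rw [add_zero] at hlim
  exact ge_of_tendsto' hlim key

end

end CARE

/-! ### Both claims assembled -/

theorem theorem2p3
    {ι : Type*} [Fintype ι]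
    {Ω : Type*} (U : MeasurableSpace Ω) [mΩ : MeasurableSpace Ω]
    (P : Measure Ω) [IsProbabilityMeasure P]
    -- the inputs of all servers
    (V : ι → Ω → CARE.ServerInput)
    (hinit : ∀ k, Measurable fun ω => (V k ω).initial)
    (harr : ∀ k t, Measurable fun ω => (V k ω).arrivals t)
    (hreq : ∀ k j, Measurable fun ω => (V k ω).requirement j)
    -- the mean service time requirement at server `k` is `1 / μ k`
    (μ : ι → ℝ≥0) (hμ : ∀ k, 0 < μ k)
    (hmean : ∀ k j, ∫⁻ ω, ((V k ω).requirement j : ℝ≥0∞) ∂P = ((μ k)⁻¹ : ℝ≥0))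
    -- the server under consideration has i.i.d. exponential service time requirements
    (i : ι)
    (hexp : ∀ j, P.map (fun ω => ((V i ω).requirement j : ℝ)) = expMeasure (μ i))
    (hindep : iIndepFun (fun j ω => (V i ω).requirement j) P)
    -- no other server completes infinitely many jobs in finite time
    (hdiv : ∀ k, k ≠ i → ∀ᵐ ω ∂P, ∑' j, ((V k ω).requirement j : ℝ≥0∞) = ∞)
    -- arrivals at server `i` do not anticipate its future service times: what has been sent to it
    -- up to time `t` is determined by its departures up to time `t` and by information `U` that is
    -- independent of its service time requirements
    (hU : U ≤ mΩ)
    (hUindep : Indep U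
      (⨆ j, MeasurableSpace.comap (fun ω => (V i ω).requirement j) inferInstance) P)
    (hadapted : ∀ t, Measurable[U ⊔ ⨆ s : ℝ≥0, ⨆ _ : s ≤ t,
      MeasurableSpace.comap (fun ω => (V i ω).departures s) inferInstance]
      fun ω => (V i ω).jobs t)
    (x : ℕ) (hx : 2 ≤ x) (m : ℕ) :
    -- the approximation quality during the interval from the `m`-th to the next message
    (∀ᵐ ω ∂P, ∀ t : ℝ≥0,
      (V i ω).msgTime (μ i) x m ≤ t → (t : ℝ≥0∞) < (V i ω).msgTime (μ i) x (m + 1) →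
        CARE.approxQuality (fun k => V k ω) μ x t ≤ ((x - 1 : ℕ) : ℕ∞)) ∧
    -- the mean duration of the interval, given that it starts with an infinite backlog
    (P {ω | (V i ω).StartsBacklogged (μ i) x m} ≠ 0 →
      ENNReal.ofReal ((x : ℝ) * ((x : ℝ) - 1) / μ i) ≤
        ∫⁻ ω, (V i ω).intervalDuration (μ i) x m
          ∂P[|{ω | (V i ω).StartsBacklogged (μ i) x m}]) := by
  have hreg := CARE.ae_mem_regularPaths (hμ i) (hreq i) (hmean i) hexp hindep
  constructor
  · have hall : ∀ᵐ ω ∂P, ∀ k, ∑' j, ((V k ω).requirement j : ℝ≥0∞) = ∞ := by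
      rw [ae_all_iff]
      intro k
      rcases eq_or_ne k i with rfl | hk
      · filter_upwards [hreg] with ω hω using hω.2
      · exact hdiv k hk
    filter_upwards [hall] with ω hω t _ _
    exact iSup_le fun k => CARE.ServerInput.approxError_le (hω k) (hμ k) (by omega) t
  · intro hP
    have hμ' : (0 : ℝ) < μ i := hμ i
    have hμ0 : (μ i : ℝ≥0∞) ≠ 0 := by simpa using (hμ i).ne'
    set B := {ω | (V i ω).StartsBacklogged (μ i) x m} with hBdef
    let C := fun n => CARE.backloggedAfter (V i) (μ i) x m n
    have hC := CARE.lintegral_backloggedAfter hU (hμ i) (hreq i) hexp hindep hUindep hadapted hreg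
      (x := x) (by omega) m
    have hdisj : Pairwise (Function.onFun Disjoint C) := by
      intro n n' hnn
      refine Set.disjoint_left.2 fun ω h h' => hnn ?_
      have := h.2.2.symm.trans h'.2.2
      exact_mod_cast this
    -- Departures by a finite time are almost surely finite in number, so the cases `n : ℕ` exhaust
    -- `B` up to a null set; measurability of `B` itself is not needed.
    have hBC : B =ᵐ[P] ⋃ n, C n := by
      filter_upwards [hreg] with ω hω
      refine propext ⟨fun h => ?_, fun h => ?_⟩
      · obtain ⟨n, hn⟩ := ENat.ne_top_iff_exists.1
          (CARE.ServerInput.departures_ne_top hω.2 ((V i ω).msgTime (μ i) x m).toNNReal)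
        exact Set.mem_iUnion.2 ⟨n, hω, h, hn.symm⟩
      · obtain ⟨n, hn⟩ := Set.mem_iUnion.1 h
        exact hn.2.1
    have hmain : ENNReal.ofReal ((x : ℝ) * ((x : ℝ) - 1)) * P B ≤
        μ i * ∫⁻ ω in B, (V i ω).intervalDuration (μ i) x m ∂P := by
      rw [Measure.restrict_congr_set hBC, measure_congr hBC,
        measure_iUnion hdisj fun n => (hC n).1, lintegral_iUnion (fun n => (hC n).1) hdisj,
        ← ENNReal.tsum_mul_left, ← ENNReal.tsum_mul_left]
      exact ENNReal.tsum_le_tsum fun n => (hC n).2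
    rw [ProbabilityTheory.cond, lintegral_smul_measure, smul_eq_mul,
      ENNReal.ofReal_div_of_pos hμ', ENNReal.ofReal_coe_nnreal,
      ENNReal.div_le_iff' hμ0 ENNReal.coe_ne_top, mul_left_comm]
    calc ENNReal.ofReal ((x : ℝ) * ((x : ℝ) - 1))
        = (P B)⁻¹ * (ENNReal.ofReal ((x : ℝ) * ((x : ℝ) - 1)) * P B) := by
          rw [mul_left_comm, ENNReal.inv_mul_cancel hP (measure_ne_top _ _), mul_one]
      _ ≤ _ := by gcongr
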